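/- Let $K$ be a field, $s\ge 1$ and $n\ge 2$. Let $\Delta$ be the cyclic quiver with vertex set $\mathbb Z/s$ and exactly one arrow $x_i: i\to i+1$ for every vertex $i$. Let $A=K\Delta/R_\Delta^n$, where $R_\Delta^n$ is the two-sided ideal of the path algebra generated by the paths of length $n$ (paths are composed from left to right). Let $D(A)=\mathrm{Hom}_K(A,K)$ with the $A$-bimodule structure $(af)(x)=f(xa)$, $(fa)(x)=f(ax)$. For a Hochschild $2$-cocycle $\alpha:A\times A\to D(A)$ with class $[\alpha]\in H^2(A,D(A))$, let $T_\alpha(A)$ be the Hochschild extension algebra: the vector space $A\oplus D(A)$ with the multiplication $(a,x)(b,y)=(ab,\,ay+xb+\alpha(a,b))$. In particular $T_0(A)=A\ltimes D(A)$ is the trivial extension. For $m,q\ge 0$ let $C_{m,q}$ be the $K$-vector space with basis the symbols $u\otimes v$, where $u$ is a path of length $q-m$ with $0\le q-m<n$, $v$ is a path of length $m$, the path $v$ starts where $u$ ends, and $v$ ends where $u$ starts; for $q-m\ge n$ put $u\otimes v=0$. Let $HH_{2,q}(A)=\operatorname{Ker}d_2/\operatorname{Im}d_3$, the degree $q$ part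 of the second Hochschild homology of $A$, where $d_3:C_{n+1,q}\to C_{n,q}$ and $d_2:C_{n,q}\to C_{1,q}$ are given by $$d_3(u\otimes y_1\cdots y_{n+1})=uy_1\otimes y_2\cdots y_{n+1}-y_{n+1}u\otimes y_1\cdots y_n,$$ $$d_2(u\otimes y_1\cdots y_n)=\sum_{j=0}^{n-1}y_{j+2}\cdots y_n\,u\,y_1\cdots y_j\otimes y_{j+1}$$ with arrows $y_i$. For a linear functional $g$ on $C_{n,q}$ let $\Theta(g):A\times A\to D(A)$ be the bilinear map such that, for paths $p,p',x$ of length $<n$, $\Theta(g)(p,p')(x)=g(wx\otimes v)$ if $pp'x$ is a cycle, $pp'$ has length at least $n$ and $pp'=vw$ with $v$ of length $n$, and $\Theta(g)(p,p')(x)=0$ otherwise. Let $\Theta(D(HH_{2,q}(A)))\subseteq H^2(A,D(A))$ be the set of the classes $[\Theta(g)]$, where $g$ is a functional on $C_{n,q}$ whose restriction to $\operatorname{Ker}d_2$ is induced by a functional on $HH_{2,q}(A)$. The ordinary quiver $\Delta_T$ of a basic finite-dimensional $K$-algebra $T$ has as vertices the members of a complete set of primitive orthogonal idempotents $\{e_i\}$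 of $T$, with $\dim_K(e_iJe_j/e_iJ^2e_j)$ arrows from $i$ to $j$, where $J$ is the Jacobson radical of $T$. Equality of quivers means isomorphism, and the statements below include that the algebras concerned are basic and that their quivers do not depend, up to isomorphism, on the chosen idempotents. Let $\alpha:A\times A\to D(A)$ be a $2$-cocycle. Then: 1. There are $2$-cocycles $\beta_q$ $(n\le q\le 2n-1)$ with $[\beta_q]\in\Theta(D(HH_{2,q}(A)))$ and $[\alpha]=\sum_{q=n}^{2n-1}[\beta_q]$. 2. For all $2$-cocycles $\beta_q$ as in 1, $$\Delta_{T_\alpha(A)}=\begin{cases}\Delta_{T_0(A)}&\text{if }[\beta_{2n-1}]=0,\\ \Delta&\text{if }[\beta_{2n-1}]\ne 0.\end{cases}$$ 3. Consequently, $\Delta_{T_\alpha(A)}$ is $\Delta_{T_0(A)}$ or $\Delta$. -/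

import Mathlib

noncomputable section

open scoped Classical

namespace HochNak

open Quiver

/-! ### Path algebras -/

section PathAlgebra

/-- The path algebra `K V` of a quiver with finitely many vertices. An element assigns to each
pair of vertices `(a, b)` a finite linear combination of paths from `a` to `b`; as there are
finitely many vertices, this is the vector space with basis all paths. -/
def PathAlgebra (K V : Type*) [Field K] [Quiver V] [Fintype V] : Type _ :=
  ∀ a b : V, Path a b →₀ K

variable (K : Type*) {V : Type*} [Field K] [Quiver V] [Fintype V]

instance : AddCommGroup (PathAlgebra K V) :=
  inferInstanceAs (AddCommGroup (∀ a b : V, Path a b →₀ K))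

instance : Module K (PathAlgebra K V) :=
  inferInstanceAs (Module K (∀ a b : V, Path a b →₀ K))

/-- The `(a, b)` component of an element of the path algebra. -/
def component (a b : V) : PathAlgebra K V →ₗ[K] (Path a b →₀ K) :=
  (LinearMap.proj b : (∀ b : V, Path a b →₀ K) →ₗ[K] (Path a b →₀ K)) ∘ₗ
    (LinearMap.proj a : (∀ a b : V, Path a b →₀ K) →ₗ[K] (∀ b : V, Path a b →₀ K))

/-- A path as an element of the path algebra. -/
def ofPath {a b : V} (p : Path a b) : PathAlgebra K V :=
  Pi.single a (Pi.single b (Finsupp.single p 1))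

/-- Bilinear extension of the concatenation of paths (first `p`, then `q`). -/
def concat (a b c : V) : (Path a b →₀ K) →ₗ[K] (Path b c →₀ K) →ₗ[K] (Path a c →₀ K) :=
  Finsupp.linearCombination K fun p =>
    Finsupp.linearCombination K fun q => Finsupp.single (p.comp q) (1 : K)

/-- The trivial path at `a` if `a = b`, and zero otherwise. -/
def unitComponent (a b : V) : Path a b →₀ K :=
  if h : a = b then Finsupp.single (h ▸ (Path.nil : Path a a)) 1 else 0

instance : Mul (PathAlgebra K V) where
  mul f g := fun a c => ∑ b, concat K a b c (f a b) (g b c)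

instance : One (PathAlgebra K V) where
  one := fun a b => unitComponent K a b

variable {K}

theorem mul_apply (f g : PathAlgebra K V) (a c : V) :
    (f * g) a c = ∑ b, concat K a b c (f a b) (g b c) := rfl

theorem one_apply (a b : V) : (1 : PathAlgebra K V) a b = unitComponent K a b := rfl

theorem add_apply (f g : PathAlgebra K V) (a b : V) : (f + g) a b = f a b + g a b := rfl

theorem zero_apply (a b : V) : (0 : PathAlgebra K V) a b = 0 := rfl

theorem smul_apply (r : K) (f : PathAlgebra K V) (a b : V) : (r • f) a b = r • f a b := rfl

theorem path_algebra_ext {f g : PathAlgebra K V} (h : ∀ a b, f a b = g a b) : f = g :=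
  funext fun a => funext fun b => h a b

theorem concat_single {a b c : V} (p : Path a b) (q : Path b c) (r t : K) :
    concat K a b c (Finsupp.single p r) (Finsupp.single q t) =
      Finsupp.single (p.comp q) (r * t) := by
  simp [concat]

theorem concat_assoc {a b c d : V} (f : Path a b →₀ K) (g : Path b c →₀ K) (h : Path c d →₀ K) :
    concat K a c d (concat K a b c f g) h = concat K a b d f (concat K b c d g h) := by
  induction f using Finsupp.induction_linear with
  | zero => simp
  | add f f' hf hf' => simp [hf, hf']
  | single p r =>
    induction g using Finsupp.induction_linear with
    | zero => simp
    | add g g' hg hg' => simp [hg, hg']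
    | single q t =>
      induction h using Finsupp.induction_linear with
      | zero => simp
      | add h h' hh hh' => simp [hh, hh']
      | single x u => simp only [concat_single, mul_assoc, Path.comp_assoc]

theorem concat_unit_left {a b : V} (f : Path a b →₀ K) :
    concat K a a b (unitComponent K a a) f = f := by
  induction f using Finsupp.induction_linear with
  | zero => simp
  | add f f' hf hf' => simp [hf, hf']
  | single p r => simp [unitComponent, concat_single]

theorem concat_unit_right {a b : V} (f : Path a b →₀ K) :
    concat K a b b f (unitComponent K b b) = f := by
  induction f using Finsupp.induction_linear with
  | zero => simp
  | add f f' hf hf' => simp [hf, hf']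
  | single p r => simp [unitComponent, concat_single]

theorem unitComponent_ne {a b : V} (h : a ≠ b) : unitComponent K a b = 0 := by
  simp [unitComponent, h]

instance : Ring (PathAlgebra K V) :=
  { (inferInstance : AddCommGroup (PathAlgebra K V)),
    (inferInstance : Mul (PathAlgebra K V)),
    (inferInstance : One (PathAlgebra K V)) with
    left_distrib := fun f g h => path_algebra_ext fun a b => by
      simp [mul_apply, add_apply, Finset.sum_add_distrib]
    right_distrib := fun f g h => path_algebra_ext fun a b => by
      simp [mul_apply, add_apply, Finset.sum_add_distrib]
    zero_mul := fun f => path_algebra_ext fun a b => by simp [mul_apply, zero_apply]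
    mul_zero := fun f => path_algebra_ext fun a b => by simp [mul_apply, zero_apply]
    mul_assoc := fun f g h => path_algebra_ext fun a d => by
      simp only [mul_apply, map_sum, LinearMap.sum_apply, concat_assoc]
      exact Finset.sum_comm
    one_mul := fun f => path_algebra_ext fun a b => by
      rw [mul_apply, Finset.sum_eq_single a]
      · simp [one_apply, concat_unit_left]
      · intro c _ hc
        simp [one_apply, unitComponent_ne (Ne.symm hc)]
      · simp
    mul_one := fun f => path_algebra_ext fun a b => by
      rw [mul_apply, Finset.sum_eq_single b]
      · simp [one_apply, concat_unit_right]
      · intro c _ hc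
        simp [one_apply, unitComponent_ne hc]
      · simp }

instance : Algebra K (PathAlgebra K V) :=
  Algebra.ofModule
    (fun r f g => path_algebra_ext fun a b => by
      simp [mul_apply, smul_apply, Finset.smul_sum])
    (fun r f g => path_algebra_ext fun a b => by
      simp [mul_apply, smul_apply, Finset.smul_sum])

end PathAlgebra

/-! ### Truncated quiver algebras -/

section Truncated

variable (K V : Type*) [Field K] [Quiver V] [Fintype V] (n : ℕ)

/-- The two-sided ideal of the path algebra generated by the paths of length `n`. -/
def pathIdeal : TwoSidedIdeal (PathAlgebra K V) :=
  TwoSidedIdeal.span {f | ∃ (a b : V) (p : Path a b), p.length = n ∧ f = ofPath K p}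

/-- The truncated quiver algebra `K V / R ^ n`. -/
abbrev TruncatedAlgebra : Type _ := PathAlgebra K V ⧸ (pathIdeal K V n).asIdeal

variable {K V n}

theorem concat_short_eq_zero {a b c : V} (f : Path a b →₀ K) (g : Path b c →₀ K)
    (hfg : (∀ p, p.length < n → f p = 0) ∨ (∀ p, p.length < n → g p = 0))
    (p : Path a c) (hp : p.length < n) : concat K a b c f g p = 0 := by
  have key : concat K a b c f g p =
      f.sum fun p₁ r => g.sum fun p₂ t => r * t * Finsupp.single (p₁.comp p₂) (1 : K) p := by
    simp only [concat, Finsupp.linearCombination_apply, Finsupp.sum, LinearMap.sum_apply,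
      LinearMap.smul_apply, Finsupp.finsetSum_apply, Finsupp.smul_apply, smul_eq_mul,
      Finset.mul_sum, mul_assoc]
  rw [key]
  refine Finset.sum_eq_zero fun p₁ _ => Finset.sum_eq_zero fun p₂ _ => ?_
  by_cases h : p₁.comp p₂ = p
  · have hl : p₁.length + p₂.length = p.length := by rw [← h, Path.length_comp]
    rcases hfg with hf | hg
    · simp [hf p₁ (by omega)]
    · simp [hg p₂ (by omega)]
  · simp [Finsupp.single_apply, h]

/-- Elements of the ideal have no component along the paths of length `< n`. -/
theorem pathIdeal_short {f : PathAlgebra K V} (hf : f ∈ pathIdeal K V n) (a b : V)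
    (p : Path a b) (hp : p.length < n) : f a b p = 0 := by
  let J : TwoSidedIdeal (PathAlgebra K V) := TwoSidedIdeal.mk'
    {f | ∀ (a b : V) (p : Path a b), p.length < n → f a b p = 0}
    (fun a b p _ => by simp [zero_apply])
    (fun {x y} hx hy a b p hp => by simp [add_apply, hx a b p hp, hy a b p hp])
    (fun {x} hx a b p hp => by
      change (-(x a b)) p = 0
      simp [hx a b p hp])
    (fun {x y} hy a b p hp => by
      rw [mul_apply, Finsupp.finsetSum_apply]
      exact Finset.sum_eq_zero fun c _ => concat_short_eq_zero _ _ (Or.inr (hy c b)) p hp)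
    (fun {x y} hx a b p hp => by
      rw [mul_apply, Finsupp.finsetSum_apply]
      exact Finset.sum_eq_zero fun c _ => concat_short_eq_zero _ _ (Or.inl (hx a c)) p hp)
  have hJ : pathIdeal K V n ≤ J := by
    refine TwoSidedIdeal.span_le.2 ?_
    rintro _ ⟨a', b', p', hp', rfl⟩
    refine (TwoSidedIdeal.mem_mk' _ _ _ _ _ _ _).2 ?_
    intro a b p hp
    by_cases ha : a = a'
    · subst ha
      by_cases hb : b = b'
      · subst hb
        have : p' ≠ p := by rintro rfl; omega
        simp [ofPath, this]
      · simp [ofPath, hb]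
    · simp [ofPath, ha]
  exact (TwoSidedIdeal.mem_mk' _ _ _ _ _ _ _).1 (hJ hf) a b p hp

variable (K V n)

/-- Deleting the paths of length `≥ n` from an element of the path algebra. -/
def truncate : PathAlgebra K V →ₗ[K] PathAlgebra K V where
  toFun f := fun a b => (f a b).filter fun p => p.length < n
  map_add' _ _ := path_algebra_ext fun _ _ => Finsupp.filter_add
  map_smul' _ _ := path_algebra_ext fun _ _ => Finsupp.filter_smul

variable {K V} in
theorem truncate_apply (f : PathAlgebra K V) (a b : V) (p : Path a b) :
    truncate K V n f a b p = if p.length < n then f a b p else 0 :=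
  Finsupp.filter_apply _ _ _

/-- The normal form of an element of `K V / R ^ n`: its unique representative that is a linear
combination of paths of length `< n`. -/
def normalForm : TruncatedAlgebra K V n →ₗ[K] PathAlgebra K V where
  toFun := Quotient.lift (s := ((pathIdeal K V n).asIdeal).quotientRel)
    (truncate K V n) (fun f g h => path_algebra_ext fun a b => by
      have h' : f - g ∈ pathIdeal K V n := by
        rw [← TwoSidedIdeal.mem_asIdeal]
        exact (Submodule.quotientRel_def _).1 h
      refine Finsupp.ext fun p => ?_
      by_cases hp : p.length < n
      · have := pathIdeal_short h' a b p hp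
        have h2 : f a b p - g a b p = 0 := this
        simpa only [truncate_apply, hp, if_true] using sub_eq_zero.1 h2
      · simp only [truncate_apply, hp, if_false])
  map_add' x y := by
    induction x using Submodule.Quotient.induction_on
    induction y using Submodule.Quotient.induction_on
    exact map_add (truncate K V n) _ _
  map_smul' r x := by
    induction x using Submodule.Quotient.induction_on
    exact map_smul (truncate K V n) r _

end Truncated

/-! ### The degree `q` part of the second Hochschild homology of a truncated quiver algebra

With `A = K V / R ^ n`, `E` the span of the vertices and `V_m` the set of paths of length `m`,
the complex `A ⊗_{E^e} K V_{n+1} → A ⊗_{E^e} K V_n → A ⊗_{E^e} K V_1` computes `HH_2(A)`; it is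
graded by total path length. -/

section Homology

/-- Splitting a path after its first `k` arrows. -/
def splitPath {V : Type*} [Quiver V] {a : V} :
    ∀ {b : V}, Path a b → ℕ → (c : V) × Path a c × Path c b
  | _, Path.nil, _ => ⟨a, Path.nil, Path.nil⟩
  | _, Path.cons p e, k =>
    if k ≤ p.length then
      ⟨(splitPath p k).1, (splitPath p k).2.1, (splitPath p k).2.2.cons e⟩
    else ⟨_, p.cons e, Path.nil⟩

/-- A basis element `u ⊗ v` of the degree `q` part of `A ⊗_{E^e} K V_m`: a path `u` that is
nonzero in `A` and a path `v` of length `m`, together forming a cycle of length `q`. -/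
structure CyclePair (V : Type*) [Quiver V] (n m q : ℕ) where
  a : V
  b : V
  u : Path a b
  v : Path b a
  short : u.length < n
  length_v : v.length = m
  total : u.length + v.length = q

variable (K V : Type*) [Field K] [Quiver V] (n : ℕ)

/-- The degree `q` part of `A ⊗_{E^e} K V_m`. -/
abbrev Chain (m q : ℕ) : Type _ := CyclePair V n m q →₀ K

/-- The class of `u ⊗ v` in the degree `q` part of `A ⊗_{E^e} K V_m`, which is zero if `u` is
zero in `A`, that is, if its length is at least `n`. -/
def bracket (m q : ℕ) {V : Type*} [Quiver V] {a b : V} (u : Path a b) (v : Path b a) :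
    Chain K V n m q :=
  if h : u.length < n ∧ v.length = m ∧ u.length + v.length = q then
    Finsupp.single ⟨a, b, u, v, h.1, h.2.1, h.2.2⟩ 1
  else 0

/-- `u ⊗ y₁ ⋯ yₙ₊₁ ↦ u y₁ ⊗ y₂ ⋯ yₙ₊₁ - yₙ₊₁ u ⊗ y₁ ⋯ yₙ`. -/
def d₃ (q : ℕ) : Chain K V n (n + 1) q →ₗ[K] Chain K V n n q :=
  Finsupp.linearCombination K fun w =>
    bracket K n n q (w.u.comp (splitPath w.v 1).2.1) (splitPath w.v 1).2.2 -
      bracket K n n q ((splitPath w.v n).2.2.comp w.u) (splitPath w.v n).2.1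

/-- `u ⊗ y₁ ⋯ yₙ ↦ ∑ⱼ yⱼ₊₂ ⋯ yₙ u y₁ ⋯ yⱼ ⊗ yⱼ₊₁`, the sum over `0 ≤ j < n`. -/
def d₂ (q : ℕ) : Chain K V n n q →ₗ[K] Chain K V n 1 q :=
  Finsupp.linearCombination K fun w =>
    ∑ j ∈ Finset.range n,
      bracket K n 1 q
        ((splitPath w.v (j + 1)).2.2.comp
          (w.u.comp (splitPath (splitPath w.v (j + 1)).2.1 j).2.1))
        (splitPath (splitPath w.v (j + 1)).2.1 j).2.2

/-- `HH_{2,q}(A) = Ker d₂ / Im d₃`, the degree `q` part of the second Hochschild homology of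
`A = K V / R ^ n`, as the image of `Ker d₂` in the quotient of the chains by `Im d₃`. -/
abbrev Homology₂ (q : ℕ) : Type _ :=
  ↥((LinearMap.ker (d₂ K V n q)).map (LinearMap.range (d₃ K V n q)).mkQ)

/-- The homology class of a cycle. -/
def homologyClass (q : ℕ) : LinearMap.ker (d₂ K V n q) →ₗ[K] Homology₂ K V n q :=
  (LinearMap.range (d₃ K V n q)).mkQ.submoduleMap (LinearMap.ker (d₂ K V n q))

end Homology

/-! ### Hochschild cohomology with coefficients in `D(A)` and Hochschild extensions -/

section Hochschild

variable (K : Type*) (A : Type*) [Field K] [Ring A] [Algebra K A]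

/-- The standard dual `D(A) = Hom_K(A, K)`. -/
def D : Type _ := A →ₗ[K] K

instance : AddCommGroup (D K A) := inferInstanceAs (AddCommGroup (A →ₗ[K] K))

instance : Module K (D K A) := inferInstanceAs (Module K (A →ₗ[K] K))

instance : FunLike (D K A) A K := inferInstanceAs (FunLike (A →ₗ[K] K) A K)

instance : LinearMapClass (D K A) K A K :=
  inferInstanceAs (LinearMapClass (A →ₗ[K] K) K A K)

/-- A linear functional as an element of `D(A)`. -/
def D.of : (A →ₗ[K] K) ≃ₗ[K] D K A := LinearEquiv.refl K _

/-- `K`-bilinear maps `A × A → D(A)`. -/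
abbrev Cochain₂ : Type _ := A →ₗ[K] A →ₗ[K] D K A

variable {K A}

@[ext] theorem D.ext {f g : D K A} (h : ∀ x, f x = g x) : f = g := LinearMap.ext h

@[simp] theorem D.of_apply (f : A →ₗ[K] K) (x : A) : D.of K A f x = f x := rfl
@[simp] theorem D.add_apply (f g : D K A) (x : A) : (f + g) x = f x + g x := rfl
@[simp] theorem D.sub_apply (f g : D K A) (x : A) : (f - g) x = f x - g x := rfl
@[simp] theorem D.neg_apply (f : D K A) (x : A) : (-f) x = -f x := rfl
@[simp] theorem D.zero_apply (x : A) : (0 : D K A) x = 0 := rfl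
@[simp] theorem D.smul_apply (r : K) (f : D K A) (x : A) : (r • f) x = r * f x := rfl

/-- The left action of `A` on `D(A)`: `(a f)(x) = f (x a)`. -/
def lact (a : A) (f : D K A) : D K A := D.of K A (((D.of K A).symm f) ∘ₗ LinearMap.mulRight K a)

/-- The right action of `A` on `D(A)`: `(f a)(x) = f (a x)`. -/
def ract (f : D K A) (a : A) : D K A := D.of K A (((D.of K A).symm f) ∘ₗ LinearMap.mulLeft K a)

@[simp] theorem lact_apply (a : A) (f : D K A) (x : A) : lact a f x = f (x * a) := rfl

@[simp] theorem ract_apply (f : D K A) (a x : A) : ract f a x = f (a * x) := rfl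

variable (K A)

/-- The space `Z²(A, D(A))` of Hochschild `2`-cocycles. -/
def cocycles : Submodule K (Cochain₂ K A) where
  carrier := {α | ∀ a b c : A,
    lact a (α b c) - α (a * b) c + α a (b * c) - ract (α a b) c = 0}
  zero_mem' := fun a b c => by ext x; simp
  add_mem' := by
    intro α β hα hβ a b c
    ext x
    have h1 := DFunLike.congr_fun (hα a b c) x
    have h2 := DFunLike.congr_fun (hβ a b c) x
    simp at h1 h2 ⊢
    linear_combination h1 + h2
  smul_mem' := by
    intro r α hα a b c
    ext x
    have h1 := DFunLike.congr_fun (hα a b c) x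
    simp at h1 ⊢
    linear_combination r * h1

/-- The space `B²(A, D(A))` of Hochschild `2`-coboundaries. -/
def coboundaries : Submodule K (Cochain₂ K A) where
  carrier := {α | ∃ φ : A →ₗ[K] D K A, ∀ a b : A,
    α a b = lact a (φ b) - φ (a * b) + ract (φ a) b}
  zero_mem' := ⟨0, fun a b => by ext x; simp⟩
  add_mem' := by
    rintro α β ⟨φ, hφ⟩ ⟨ψ, hψ⟩
    refine ⟨φ + ψ, fun a b => ?_⟩
    ext x
    simp [hφ, hψ]
    ring
  smul_mem' := by
    rintro r α ⟨φ, hφ⟩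
    refine ⟨r • φ, fun a b => ?_⟩
    ext x
    simp [hφ]
    ring

/-- The second Hochschild cohomology `H²(A, D(A)) = Z² / B²`, as the image of `Z²` in the quotient
of the `2`-cochains by `B²`. -/
abbrev Cohomology₂ : Type _ := ↥((cocycles K A).map (coboundaries K A).mkQ)

variable {K A}

/-- The cohomology class of a `2`-cocycle. -/
def cls : cocycles K A →ₗ[K] Cohomology₂ K A :=
  (coboundaries K A).mkQ.submoduleMap (cocycles K A)

theorem cocycle_apply (α : cocycles K A) (a b c x : A) :
    α.1 b c (x * a) - α.1 (a * b) c x + α.1 a (b * c) x - α.1 a b (c * x) = 0 := by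
  simpa using DFunLike.congr_fun (α.2 a b c) x

/-- The Hochschild extension algebra `T_α(A)`, with underlying vector space `A ⊕ D(A)`. -/
def Ext (_α : cocycles K A) : Type _ := A × D K A

variable (α : cocycles K A)

instance : AddCommGroup (Ext α) := inferInstanceAs (AddCommGroup (A × D K A))

instance : Module K (Ext α) := inferInstanceAs (Module K (A × D K A))

/-- `(a, x) (b, y) = (a b, a y + x b + α(a, b))`. -/
instance : Mul (Ext α) where
  mul s t := (s.1 * t.1, lact s.1 t.2 + ract s.2 t.1 + α.1 s.1 t.1)

instance : One (Ext α) where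
  one := (1, -α.1 1 1)

variable {α}

theorem Ext.ext_iff' {s t : Ext α} (h1 : s.1 = t.1) (h2 : ∀ x, s.2 x = t.2 x) : s = t :=
  Prod.ext h1 (D.ext h2)

@[simp] theorem Ext.mul_fst (s t : Ext α) : (s * t).1 = s.1 * t.1 := rfl
@[simp] theorem Ext.mul_snd (s t : Ext α) :
    (s * t).2 = lact s.1 t.2 + ract s.2 t.1 + α.1 s.1 t.1 := rfl
@[simp] theorem Ext.one_fst : (1 : Ext α).1 = 1 := rfl
@[simp] theorem Ext.one_snd : (1 : Ext α).2 = -α.1 1 1 := rfl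
@[simp] theorem Ext.add_fst (s t : Ext α) : (s + t).1 = s.1 + t.1 := rfl
@[simp] theorem Ext.add_snd (s t : Ext α) : (s + t).2 = s.2 + t.2 := rfl
@[simp] theorem Ext.zero_fst : (0 : Ext α).1 = 0 := rfl
@[simp] theorem Ext.zero_snd : (0 : Ext α).2 = 0 := rfl
@[simp] theorem Ext.smul_fst (r : K) (s : Ext α) : (r • s).1 = r • s.1 := rfl
@[simp] theorem Ext.smul_snd (r : K) (s : Ext α) : (r • s).2 = r • s.2 := rfl

instance : Ring (Ext α) :=
  { (inferInstance : AddCommGroup (Ext α)),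
    (inferInstance : Mul (Ext α)),
    (inferInstance : One (Ext α)) with
    left_distrib := fun s t u => Ext.ext_iff' (by simp [mul_add]) fun x => by
      simp [mul_add, add_mul]; ring
    right_distrib := fun s t u => Ext.ext_iff' (by simp [add_mul]) fun x => by
      simp [mul_add, add_mul]; ring
    zero_mul := fun s => Ext.ext_iff' (by simp) fun x => by simp
    mul_zero := fun s => Ext.ext_iff' (by simp) fun x => by simp
    mul_assoc := fun s t u => Ext.ext_iff' (by simp [mul_assoc]) fun x => by
      have h := cocycle_apply α s.1 t.1 u.1 x
      simp [mul_assoc]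
      linear_combination -h
    one_mul := fun s => Ext.ext_iff' (by simp) fun x => by
      have h := cocycle_apply α 1 1 s.1 x
      simp at h ⊢
      linear_combination h
    mul_one := fun s => Ext.ext_iff' (by simp) fun x => by
      have h := cocycle_apply α s.1 1 1 x
      simp at h ⊢
      linear_combination -h }

instance : Algebra K (Ext α) :=
  Algebra.ofModule
    (fun r s t => Ext.ext_iff' (by simp) fun x => by simp)
    (fun r s t => Ext.ext_iff' (by simp) fun x => by simp)

end Hochschild

/-! ### The map `Θ` from `D(HH_{2,q}(A))` to `H²(A, D(A))` -/

section Theta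

variable {K V : Type*} [Field K] [Quiver V] [Fintype V] {n q : ℕ}

/-- For a functional `g` on the degree `q` part of `A ⊗_{E^e} K V_n` and paths `p`, `p'`, `x`:
the value `g (w x ⊗ v)` if `p p' = v w` with `v` of length `n`, and zero if `p p'` has length
less than `n`. -/
def thetaValue (g : Module.Dual K (Chain K V n n q)) {a b c : V}
    (p : Path a b) (p' : Path b c) (x : Path c a) : K :=
  if n ≤ (p.comp p').length then
    g (bracket K n n q ((splitPath (p.comp p') n).2.2.comp x) (splitPath (p.comp p') n).2.1)
  else 0

/-- The trilinear extension of `thetaValue`. -/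
def thetaForm (g : Module.Dual K (Chain K V n n q)) (a b c : V) :
    (Path a b →₀ K) →ₗ[K] (Path b c →₀ K) →ₗ[K] (Path c a →₀ K) →ₗ[K] K :=
  Finsupp.linearCombination K fun p =>
    Finsupp.linearCombination K fun p' =>
      Finsupp.linearCombination K fun x => thetaValue g p p' x

/-- The map `Θ : D((A ⊗_{E^e} K V_n)_q) → Hom_K(A ⊗ A, D(A))`. On (nonzero) paths `p`, `p'`, `x`
of `A` forming a cycle, `Θ(g)(p, p')(x) = g (w x ⊗ v)` if `p p' = v w` with `v` of length `n`;
all other values on paths are zero. -/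
def theta (g : Module.Dual K (Chain K V n n q)) : Cochain₂ K (TruncatedAlgebra K V n) :=
  LinearMap.mk₂ K
    (fun s t => D.of K _ (∑ a : V, ∑ b : V, ∑ c : V,
      thetaForm g a b c (component K a b (normalForm K V n s))
          (component K b c (normalForm K V n t)) ∘ₗ
        component K c a ∘ₗ normalForm K V n))
    (fun s s' t => by
      rw [← map_add]
      simp [LinearMap.add_comp, Finset.sum_add_distrib])
    (fun r s t => by
      rw [← map_smul]
      simp [LinearMap.smul_comp, Finset.smul_sum])
    (fun s t t' => by
      rw [← map_add]
      simp [LinearMap.add_comp, Finset.sum_add_distrib])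
    (fun r s t => by
      rw [← map_smul]
      simp [LinearMap.smul_comp, Finset.smul_sum])

/-- The subset `Θ(D(HH_{2,q}(A)))` of `H²(A, D(A))`, for `A = K V / R ^ n`: the classes of the
cocycles `Θ(g)`, where the functional `g` on the degree `q` part of `A ⊗_{E^e} K V_n` extends
a functional `f` on `HH_{2,q}(A)` (viewed as a functional on the cycles). -/
def thetaImage (K V : Type*) [Field K] [Quiver V] [Fintype V] (n q : ℕ) :
    Set (Cohomology₂ K (TruncatedAlgebra K V n)) :=
  {c | ∃ (f : Module.Dual K (Homology₂ K V n q)) (g : Module.Dual K (Chain K V n n q))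
      (γ : cocycles K (TruncatedAlgebra K V n)),
      (∀ z : LinearMap.ker (d₂ K V n q), g z = f (homologyClass K V n q z)) ∧
      γ.1 = theta g ∧ c = cls γ}

end Theta

/-! ### The ordinary quiver of a basic finite-dimensional algebra -/

section OrdinaryQuiver

/-- A primitive idempotent: nonzero, and not a sum of two nonzero orthogonal idempotents. -/
def IsPrimitive {R : Type*} [Ring R] (e : R) : Prop :=
  IsIdempotentElem e ∧ e ≠ 0 ∧
    ∀ f g : R, IsIdempotentElem f → IsIdempotentElem g → f * g = 0 → g * f = 0 →
      f + g = e → f = 0 ∨ g = 0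

/-- A complete set of primitive orthogonal idempotents of a basic algebra: the projective modules
`R eᵢ` are pairwise non-isomorphic. -/
structure IsBasicSystem {R : Type*} [Ring R] {ι : Type*} [Fintype ι] (e : ι → R) : Prop where
  complete : CompleteOrthogonalIdempotents e
  primitive : ∀ i, IsPrimitive (e i)
  basic : ∀ i j, Nonempty ((Submodule.span R {e i}) ≃ₗ[R] (Submodule.span R {e j})) → i = j

variable (K : Type*) {R : Type*} [Field K] [Ring R] [Algebra K R]

/-- The Jacobson radical as a `K`-subspace. -/
def radical (R : Type*) [Ring R] [Algebra K R] : Submodule K R :=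
  (Ring.jacobson R).restrictScalars K

/-- The subspace `e M f`. -/
def corner (e f : R) (M : Submodule K R) : Submodule K R :=
  M.map (LinearMap.mulLeft K e ∘ₗ LinearMap.mulRight K f)

/-- `dim_K (e J f / e J² f)`, where `J` is the Jacobson radical. -/
def numArrows (e f : R) : ℕ :=
  Module.finrank K
    (corner K e f (radical K R) ⧸
      (corner K e f (radical K R * radical K R)).submoduleOf (corner K e f (radical K R)))

/-- The quiver on the index set of a system of idempotents, with
`dim_K (eᵢ J eⱼ / eᵢ J² eⱼ)` arrows from `i` to `j`. -/
abbrev quiverOf {ι : Type} (e : ι → R) : Quiver.{0} ι :=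
  ⟨fun i j => Fin (numArrows K (e i) (e j))⟩

/-- Isomorphism of quivers. -/
def QuiverIso {V W : Type} (Q : Quiver.{0} V) (Q' : Quiver.{0} W) : Prop :=
  ∃ φ : V ≃ W, ∀ i j : V, Nonempty (Q.Hom i j ≃ Q'.Hom (φ i) (φ j))

/-- `Q` is the ordinary quiver of `R`, that is, `R` is basic, and `Q` is isomorphic to the quiver
given by any complete set of primitive orthogonal idempotents of `R`. -/
def HasOrdinaryQuiver (R : Type*) [Ring R] [Algebra K R] {V : Type} (Q : Quiver.{0} V) : Prop :=
  (∃ (ι : Type) (_ : Fintype ι) (e : ι → R), IsBasicSystem e) ∧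
    ∀ (ι : Type) (_ : Fintype ι) (e : ι → R), IsBasicSystem e → QuiverIso (quiverOf K e) Q

/-- `R` and `R'` have the same ordinary quiver. -/
def SameOrdinaryQuiver (R R' : Type*) [Ring R] [Algebra K R] [Ring R'] [Algebra K R'] : Prop :=
  ∃ (V : Type) (Q : Quiver.{0} V), HasOrdinaryQuiver K R Q ∧ HasOrdinaryQuiver K R' Q

end OrdinaryQuiver

/-! ### The cyclic quiver -/

/-- The vertices of the cyclic quiver with `s` vertices. -/
def Cyc (s : ℕ) : Type := ZMod s

instance (s : ℕ) [NeZero s] : Fintype (Cyc s) := inferInstanceAs (Fintype (ZMod s))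

/-- The cyclic quiver: exactly one arrow from `i` to `i + 1` for each `i` modulo `s`. -/
instance cyclicQuiver (s : ℕ) : Quiver.{0} (Cyc s) :=
  ⟨fun i j => PLift ((show ZMod s from i) + 1 = (show ZMod s from j))⟩

/-- The truncated cycle algebra `K Δ / R ^ n`, where `Δ` is the cyclic quiver with `s` vertices. -/
abbrev CycleAlgebra (K : Type*) [Field K] (s n : ℕ) [NeZero s] : Type _ :=
  TruncatedAlgebra K (Cyc s) n

/-- A decomposition `[α] = ∑_{q=n}^{2n-1} [β_q]` with `[β_q]` in `Θ(D(HH_{2,q}(A)))`. -/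
def IsDecomposition {K : Type*} [Field K] {s n : ℕ} [NeZero s]
    (α : cocycles K (CycleAlgebra K s n)) (β : ℕ → cocycles K (CycleAlgebra K s n)) : Prop :=
  (∀ q ∈ Finset.Icc n (2 * n - 1), cls (β q) ∈ thetaImage K (Cyc s) n q) ∧
    cls α = ∑ q ∈ Finset.Icc n (2 * n - 1), cls (β q)

end HochNak

end

/-!
A path of the cyclic quiver is determined by its source and its length, so `A` has a basis of paths
`pathAt i l` with `l < n`. With `X` the sum of all arrows, `pathAt i l` is `eᵢ X ^ l`.

*Decomposition.* Let `T` be the extension given by a cocycle. The kernel of `T → A` has square zero,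
so the vertices lift to orthogonal idempotents `Eᵢ` of `T`, and `X` lifts to some `Y` with
`Eᵢ Y = Y Eᵢ₊₁` (`exists_isArrowLift`). Sending `eᵢ X ^ l` to `Eᵢ Y ^ l` for `l < n` gives a section
of `T → A`. Its failure to be multiplicative is measured by `Y ^ n`, which is an element of `D(A)`.
Hence the cocycle is cohomologous to one whose value on `p, p'` is `Y ^ n` acted on by the last
part of `p p'`. Sorting the values of `Y ^ n` by length of paths exhibits it as a sum of cocycles
`Θ(g)` (`IsArrowLift.sec_mul_sub`). Since `Y` commutes with `Y ^ n`, the functionals `g` of degree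
above `n` are constant on the chain basis, which says that they vanish on the image of `d₃`.

*Quivers.* If `χ : R → K ^ V` is surjective with nil kernel, then the kernel is the radical `J`,
and the complete systems of primitive orthogonal idempotents of `R` are the lifts of the
coordinate idempotents. A linear map `Φ : R → K ^ W` that is a derivation over `χ` and induces an
isomorphism `J / J ^ 2 ≃ K ^ W` therefore exhibits `W` as the set of arrows
(`hasOrdinaryQuiver_of_arrows`). For an extension, `J / J ^ 2` is spanned by the arrows of `Δ` and
by `D(A)` modulo `J ^ 2`. The functionals which vanish on the paths of length `n - 1` always lie
in `J ^ 2` (`extInr_mem_radical_sq`), so only the restriction of the cocycle to such paths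
matters. On these, a decomposition only retains its component of degree `2 n - 1`
(`IsDecomposition.apply_socle`). If the class of this component vanishes, the values of the
cocycle there are those of a coboundary, and one gets the quiver of the trivial extension.
Otherwise `g` is a nonzero constant, the product of `X ^ (n - 1)` and `X` in the extension is a
functional that is nonzero on all paths of length `n - 1`, and so `D(A)` lies in `J ^ 2`.
Coboundaries do not affect this value, since they involve only products of length at least `n`.
-/

noncomputable section

open scoped Classical

namespace HochNak

open Quiver

/-! ### Algebras whose radical quotient is a power of the field -/

section QuiverCriterion

theorem idempotent_eq_zero_or_one {V K : Type*} [Field K] {f : V → K} (hf : IsIdempotentElem f)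
    (v : V) : f v = 0 ∨ f v = 1 := by
  have h := congrFun hf.eq v
  simp only [Pi.mul_apply] at h
  exact IsIdempotentElem.iff_eq_zero_or_one.1 h

theorem eq_zero_of_idempotent_of_nilpotent {R : Type*} [Ring R] {e : R}
    (he : IsIdempotentElem e) (h : IsNilpotent e) : e = 0 := by
  obtain ⟨k, hk⟩ := h
  rcases Nat.eq_zero_or_pos k with rfl | hk0
  · have : (1 : R) = 0 := by simpa using hk
    calc e = e * 1 := (mul_one e).symm
      _ = 0 := by rw [this, mul_zero]
  · rw [← he.pow_eq (by omega : k ≠ 0), hk]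

variable {K R V W : Type*} [Field K] [Ring R] [Algebra K R] {χ : R →ₐ[K] (V → K)}

/-- A homomorphism to a power of `K` whose kernel is nil has the Jacobson radical as kernel. -/
theorem mem_radical_iff (hχ : Function.Surjective χ) (hnil : ∀ t, χ t = 0 → IsNilpotent t)
    (t : R) : t ∈ radical K R ↔ χ t = 0 := by
  change t ∈ Ring.jacobson R ↔ _
  constructor
  · intro ht
    ext v
    let f : R →+* K := (Pi.evalRingHom (fun _ : V => K) v).comp χ.toRingHom
    have hf : Function.Surjective f := fun c => by
      obtain ⟨r, hr⟩ := hχ (fun _ => c)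
      exact ⟨r, by simp [f, hr]⟩
    have : (RingHom.ker f).IsMaximal := RingHom.ker_isMaximal_of_surjective f hf
    have h := Ring.jacobson_le_of_isMaximal (RingHom.ker f) ht
    simpa [f, RingHom.mem_ker] using h
  · intro ht
    rw [← Ideal.jacobson_bot, Ideal.mem_jacobson_iff]
    intro y
    have hn : IsNilpotent (y * t) := hnil _ (by simp [ht])
    obtain ⟨u, hu⟩ := hn.isUnit_one_add
    refine ⟨↑u⁻¹, ?_⟩
    have h1 : (↑u⁻¹ : R) * (1 + y * t) = 1 := by rw [← hu]; simp
    rw [Ideal.mem_bot, ← h1]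
    noncomm_ring

variable [Fintype V]

/-- The coordinate idempotents lift to a complete system, and the lifts are primitive with
pairwise non-isomorphic projective modules. -/
theorem exists_isBasicSystem (hχ : Function.Surjective χ)
    (hnil : ∀ t, χ t = 0 → IsNilpotent t) :
    ∃ e : V → R, IsBasicSystem e := by
  obtain ⟨e, he, hχe⟩ :=
    (CompleteOrthogonalIdempotents.single (fun _ : V => K)).lift_of_isNilpotent_ker
      χ.toRingHom (fun x hx => hnil x hx) (fun i => hχ _)
  have hχe' : ∀ i, χ (e i) = Pi.single i 1 := fun i => congrFun hχe i
  refine ⟨e, he, fun i => ⟨he.idem i, ?_, ?_⟩, ?_⟩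
  · intro h
    have := congrFun (hχe' i) i
    simp [h] at this
  · intro f g hf hg hfg hgf hsum
    have hf0 := idempotent_eq_zero_or_one (hf.map χ)
    have hg0 := idempotent_eq_zero_or_one (hg.map χ)
    have hprod : ∀ v, χ f v * χ g v = 0 := fun v => by
      have := congrFun (congrArg χ hfg) v
      simpa using this
    have hadd : ∀ v, χ f v + χ g v = (Pi.single i 1 : V → K) v := fun v => by
      rw [← hχe' i, ← hsum]; simp
    -- Off the vertex `i` both idempotents vanish; at `i` exactly one of them does.
    have hoff : ∀ v, v ≠ i → χ f v = 0 ∧ χ g v = 0 := by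
      intro v hv
      have h1 := hadd v
      have h2 := hprod v
      rw [Pi.single_eq_of_ne hv] at h1
      rcases hf0 v with h | h <;> rcases hg0 v with h' | h' <;> simp_all
    rcases mul_eq_zero.1 (hprod i) with h | h
    · left
      refine eq_zero_of_idempotent_of_nilpotent hf (hnil f ?_)
      ext v
      by_cases hv : v = i
      · subst hv; exact h
      · exact (hoff v hv).1
    · right
      refine eq_zero_of_idempotent_of_nilpotent hg (hnil g ?_)
      ext v
      by_cases hv : v = i
      · subst hv; exact h
      · exact (hoff v hv).2
  · rintro i j ⟨F⟩
    by_contra hij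
    let ei : Submodule.span R {e i} := ⟨e i, Submodule.mem_span_singleton_self _⟩
    let ej : Submodule.span R {e j} := ⟨e j, Submodule.mem_span_singleton_self _⟩
    -- The isomorphism and its inverse are right multiplication by `a = e i a e j` and by `b`.
    obtain ⟨a, ha⟩ := Submodule.mem_span_singleton.1 (F ei).2
    obtain ⟨b, hb⟩ := Submodule.mem_span_singleton.1 (F.symm ej).2
    have h1 : e i * (a * e j) = a * e j := by
      have h : e i • F ei = F ei := by
        rw [← map_smul]
        congr 1
        exact Subtype.ext (he.idem i)
      have h := congrArg Subtype.val h
      rw [Submodule.coe_smul, ← ha] at h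
      simpa using h
    have h2 : (a * e j) * (b * e i) = e i := by
      have h : F.symm (F ei) = (a * e j) • F.symm ej := by
        rw [← map_smul]
        congr 1
        refine Subtype.ext ?_
        rw [Submodule.coe_smul, ← ha]
        simp [ej, mul_assoc, (he.idem j).eq]
      rw [LinearEquiv.symm_apply_apply] at h
      have h := congrArg Subtype.val h
      rw [Submodule.coe_smul, ← hb] at h
      simpa using h.symm
    have h3 := congrFun (congrArg χ h2) i
    simp [hχe', hij] at h3

/-- The idempotents of any complete primitive orthogonal system are lifts of the coordinate
idempotents. -/
theorem exists_equiv_of_isBasicSystem (hχ : Function.Surjective χ)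
    (hnil : ∀ t, χ t = 0 → IsNilpotent t) {ι : Type*} [Fintype ι] {e : ι → R}
    (he : IsBasicSystem e) : ∃ φ : ι ≃ V, ∀ k, χ (e k) = Pi.single (φ k) 1 := by
  have h01 : ∀ k v, χ (e k) v = 0 ∨ χ (e k) v = 1 := fun k =>
    idempotent_eq_zero_or_one ((he.complete.idem k).map χ)
  -- Each idempotent is nonzero modulo the radical, at exactly one vertex by primitivity.
  have hex : ∀ k, ∃ v, χ (e k) v = 1 := by
    intro k
    by_contra! h
    refine (he.primitive k).2.1 (eq_zero_of_idempotent_of_nilpotent (he.complete.idem k)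
      (hnil _ ?_))
    ext v
    exact (h01 k v).resolve_right (h v)
  have huniq : ∀ k v w, χ (e k) v = 1 → χ (e k) w = 1 → v = w := by
    intro k v w hv hw
    by_contra hvw
    have hone : χ (1 - e k) = 1 - χ (e k) := by simp
    have hz1 : (Pi.single v 1 : V → K) * χ (1 - e k) = 0 := by
      rw [hone]
      ext u
      by_cases hu : u = v
      · subst hu; simp [hv]
      · simp [hu]
    obtain ⟨f, hf, hχf, hf1, hf2⟩ := exists_isIdempotentElem_mul_eq_zero_of_ker_isNilpotent
      χ.toRingHom (fun x hx => hnil x hx) (Pi.single v 1) (hχ _)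
      ((CompleteOrthogonalIdempotents.single (fun _ : V => K)).idem v)
      (1 - e k) (he.complete.idem k).one_sub hz1 (by rw [mul_comm]; exact hz1)
    have hχf' : χ f = Pi.single v 1 := hχf
    have hfe : f * e k = f := by
      rw [mul_sub, mul_one, sub_eq_zero] at hf1; exact hf1.symm
    have hef : e k * f = f := by
      rw [sub_mul, one_mul, sub_eq_zero] at hf2; exact hf2.symm
    have hidem : IsIdempotentElem (e k - f) := by
      change (e k - f) * (e k - f) = e k - f
      rw [mul_sub, sub_mul, sub_mul, (he.complete.idem k).eq, hfe, hef, hf.eq]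
      abel
    rcases (he.primitive k).2.2 f (e k - f) hf hidem
        (by rw [mul_sub, hfe, hf.eq, sub_self]) (by rw [sub_mul, hef, hf.eq, sub_self])
        (by abel) with h | h
    · have := congrFun hχf' v
      simp [h] at this
    · rw [sub_eq_zero] at h
      rw [h, hχf'] at hw
      simp [Ne.symm hvw] at hw
  choose φ hφ using hex
  have hsum : ∀ v, ∑ k, χ (e k) v = 1 := fun v => by
    have := congrFun (congrArg χ he.complete.complete) v
    simpa using this
  have hinj : Function.Injective φ := by
    intro k l hkl
    by_contra h
    have := congrFun (congrArg χ (he.complete.ortho h)) (φ k)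
    simp [hφ k] at this
    rw [hkl, hφ l] at this
    exact one_ne_zero this
  have hsurj : Function.Surjective φ := by
    intro v
    by_contra! h
    have h0 : ∀ k, χ (e k) v = 0 := fun k =>
      (h01 k v).resolve_right fun h1 => h k (huniq k _ _ (hφ k) h1)
    have := hsum v
    simp [h0] at this
  have hbij : Function.Bijective φ := ⟨hinj, hsurj⟩
  refine ⟨Equiv.ofBijective φ hbij, fun k => ?_⟩
  ext v
  rw [Equiv.ofBijective_apply]
  by_cases hv : v = φ k
  · subst hv; simp [hφ k]
  · simpa [hv] using (h01 k v).resolve_right fun h1 => hv (huniq k _ _ h1 (hφ k))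

variable [Fintype W] {Φ : R →ₗ[K] (W → K)} {src tgt : W → V}

omit [Fintype V] in
/-- If `Φ` identifies `J / J²` with the bimodule spanned by a set of arrows `W`, then `eᵢ J eⱼ`
modulo `eᵢ J² eⱼ` has the arrows from `i` to `j` as a basis. -/
theorem numArrows_eq_card (hχ : Function.Surjective χ) (hnil : ∀ t, χ t = 0 → IsNilpotent t)
    (hΦ : ∀ s t w, Φ (s * t) w = χ s (src w) * Φ t w + Φ s w * χ t (tgt w))
    (hker : ∀ t, χ t = 0 → Φ t = 0 → t ∈ radical K R * radical K R)
    (hsurj : ∀ c, ∃ t, χ t = 0 ∧ Φ t = c) {e f : R} (he : IsIdempotentElem e)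
    (hf : IsIdempotentElem f) {i j : V} (hei : χ e = Pi.single i 1) (hfj : χ f = Pi.single j 1) :
    numArrows K e f = Fintype.card {w // src w = i ∧ tgt w = j} := by
  have hrad := mem_radical_iff (K := K) hχ hnil
  have hsq : ∀ t ∈ radical K R * radical K R, t ∈ radical K R ∧ Φ t = 0 := by
    intro t ht
    induction ht using Submodule.mul_induction_on' with
    | mem_mul_mem s hs t ht =>
      rw [hrad] at hs ht
      refine ⟨(hrad _).2 (by simp [hs]), ?_⟩
      ext w
      simp [hΦ, hs, ht]
    | add s _ t _ hs ht => exact ⟨add_mem hs.1 ht.1, by simp [hs.2, ht.2]⟩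
  have hcorner : ∀ t ∈ radical K R, ∀ w, Φ (e * (t * f)) w =
      if src w = i ∧ tgt w = j then Φ t w else 0 := by
    intro t ht w
    rw [hrad] at ht
    rw [hΦ, hΦ, map_mul, ht, hei, hfj]
    by_cases h1 : src w = i <;> by_cases h2 : tgt w = j <;> simp [h1, h2]
  have hmem : ∀ (M : Submodule K R) (m : R), m ∈ corner K e f M ↔ ∃ t ∈ M, e * (t * f) = m :=
    fun M m => by simp [corner]
  have hJ : ∀ t ∈ radical K R, e * (t * f) ∈ radical K R := fun t ht => by
    rw [hrad] at ht ⊢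
    simp [ht]
  let F : corner K e f (radical K R) →ₗ[K] ({w // src w = i ∧ tgt w = j} → K) :=
    (LinearMap.funLeft K K Subtype.val ∘ₗ Φ) ∘ₗ Submodule.subtype _
  have hF : ∀ m w, F m w = Φ m.1 w.1 := fun _ _ => rfl
  have hkerF : LinearMap.ker F = (corner K e f (radical K R * radical K R)).submoduleOf
      (corner K e f (radical K R)) := by
    ext ⟨m, hm⟩
    rw [LinearMap.mem_ker]
    change _ ↔ m ∈ corner K e f (radical K R * radical K R)
    obtain ⟨t, ht, rfl⟩ := (hmem _ _).1 hm
    constructor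
    · intro h
      have h0 : Φ (e * (t * f)) = 0 := by
        ext w
        by_cases hw : src w = i ∧ tgt w = j
        · exact congrFun h ⟨w, hw⟩
        · rw [hcorner t ht, if_neg hw]; rfl
      refine (hmem _ _).2 ⟨e * (t * f), hker _ ((hrad _).1 (hJ t ht)) h0, ?_⟩
      rw [mul_assoc, mul_assoc, hf.eq, ← mul_assoc e e, he.eq]
    · intro h
      obtain ⟨t', ht', heq⟩ := (hmem _ _).1 h
      ext w
      rw [hF]
      change Φ (e * (t * f)) w.1 = 0
      rw [← heq, hcorner t' (hsq t' ht').1, (hsq t' ht').2]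
      simp
  have hsurjF : Function.Surjective F := by
    intro c
    obtain ⟨t, ht, htc⟩ := hsurj fun w => if h : src w = i ∧ tgt w = j then c ⟨w, h⟩ else 0
    refine ⟨⟨e * (t * f), (hmem _ _).2 ⟨t, (hrad t).2 ht, rfl⟩⟩, ?_⟩
    ext ⟨w, hw⟩
    rw [hF]
    change Φ (e * (t * f)) w = _
    rw [hcorner t ((hrad t).2 ht), if_pos hw, htc]
    exact dif_pos hw
  unfold numArrows
  rw [← hkerF, (F.quotKerEquivOfSurjective hsurjF).finrank_eq, Module.finrank_pi]

end QuiverCriterion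

/-- Criterion for the ordinary quiver: `χ` splits off the radical, and `Φ` identifies `J / J²`
with the bimodule spanned by the arrows `W`. -/
theorem hasOrdinaryQuiver_of_arrows {K R : Type*} {V W : Type} [Field K] [Ring R] [Algebra K R]
    [Fintype V] [Fintype W] {χ : R →ₐ[K] (V → K)} {Φ : R →ₗ[K] (W → K)} {src tgt : W → V}
    (hχ : Function.Surjective χ) (hnil : ∀ t, χ t = 0 → IsNilpotent t)
    (hΦ : ∀ s t w, Φ (s * t) w = χ s (src w) * Φ t w + Φ s w * χ t (tgt w))
    (hker : ∀ t, χ t = 0 → Φ t = 0 → t ∈ radical K R * radical K R)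
    (hsurj : ∀ c, ∃ t, χ t = 0 ∧ Φ t = c) (Q : Quiver.{0} V)
    (hQ : ∀ i j, Nonempty ({w // src w = i ∧ tgt w = j} ≃ Q.Hom i j)) :
    HasOrdinaryQuiver K R Q := by
  obtain ⟨e, he⟩ := exists_isBasicSystem (χ := χ) hχ hnil
  refine ⟨⟨V, inferInstance, e, he⟩, fun ι _ e he => ?_⟩
  obtain ⟨φ, hφ⟩ := exists_equiv_of_isBasicSystem (χ := χ) hχ hnil he
  refine ⟨φ, fun k l => ?_⟩
  obtain ⟨E⟩ := hQ (φ k) (φ l)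
  have h := numArrows_eq_card hχ hnil hΦ hker hsurj (he.complete.idem k) (he.complete.idem l)
    (hφ k) (hφ l)
  exact ⟨((finCongr h).trans (Fintype.equivFin _).symm).trans E⟩

/-! ### Paths in truncated quiver algebras -/

section PathClasses

variable {K V : Type*} [Field K] [Quiver V] [Fintype V] {n : ℕ}

theorem ofPath_mul {a b c : V} (p : Path a b) (q : Path b c) :
    ofPath K p * ofPath K q = ofPath K (p.comp q) := by
  refine path_algebra_ext fun x y => ?_
  rw [mul_apply]
  by_cases hx : x = a
  · subst hx
    rw [Finset.sum_eq_single b]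
    · by_cases hy : y = c
      · subst hy; simp [ofPath, concat_single]
      · simp [ofPath, hy]
    · intro d _ hd
      simp [ofPath, hd]
    · simp
  · simp [ofPath, hx]

theorem ofPath_mul_of_ne {a b c d : V} (h : b ≠ c) (p : Path a b) (q : Path c d) :
    ofPath K p * ofPath K q = 0 := by
  refine path_algebra_ext fun x y => ?_
  rw [mul_apply, zero_apply]
  refine Finset.sum_eq_zero fun z _ => ?_
  by_cases hx : x = a
  · subst hx
    by_cases hz : z = b
    · subst hz; simp [ofPath, h]
    · simp [ofPath, hz]
  · simp [ofPath, hx]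

variable (K n) in
/-- The class of a path in the truncated algebra. -/
def pathClass {a b : V} (p : Path a b) : TruncatedAlgebra K V n :=
  (pathIdeal K V n).asIdeal.mkQ (ofPath K p)

theorem pathClass_mul {a b c : V} (p : Path a b) (q : Path b c) :
    pathClass K n p * pathClass K n q = pathClass K n (p.comp q) := by
  change Ideal.Quotient.mk _ (ofPath K p * ofPath K q) = _
  rw [ofPath_mul]; rfl

theorem pathClass_mul_of_ne {a b c d : V} (h : b ≠ c) (p : Path a b) (q : Path c d) :
    pathClass K n p * pathClass K n q = 0 := by
  change Ideal.Quotient.mk _ (ofPath K p * ofPath K q) = 0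
  rw [ofPath_mul_of_ne h]; exact map_zero _

theorem pathClass_of_length_le {a b : V} (p : Path a b) (hp : n ≤ p.length) :
    pathClass K n p = 0 := by
  -- The first `n` arrows of `p` already generate an element of the ideal.
  have key : ∀ {b : V} (p : Path a b), n ≤ p.length → ofPath K p ∈ pathIdeal K V n := by
    intro b p
    induction p with
    | nil =>
      intro h
      exact TwoSidedIdeal.subset_span ⟨_, _, _, by simp at h; simp [h], rfl⟩
    | cons p e ih =>
      intro h
      rcases Nat.lt_or_ge p.length n with h' | h'
      · exact TwoSidedIdeal.subset_span ⟨_, _, _, by simp at h ⊢; omega, rfl⟩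
      · have := (pathIdeal K V n).mul_mem_right _ (ofPath K e.toPath) (ih h')
        rw [ofPath_mul] at this
        exact this
  exact (Submodule.Quotient.mk_eq_zero _).2 (by simpa using key p hp)

theorem normalForm_pathClass {a b : V} (p : Path a b) (hp : p.length < n) :
    normalForm K V n (pathClass K n p) = ofPath K p := by
  change truncate K V n (ofPath K p) = _
  refine path_algebra_ext fun x y => Finsupp.ext fun r => ?_
  rw [truncate_apply]
  split_ifs with h
  · rfl
  · by_cases hx : x = a
    · subst hx
      by_cases hy : y = b
      · subst hy
        have : p ≠ r := by rintro rfl; exact h hp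
        simp [ofPath, this]
      · simp [ofPath, hy]
    · simp [ofPath, hx]

theorem pathAlgebra_hom_ext {M : Type*} [AddCommGroup M] [Module K M]
    {F G : PathAlgebra K V →ₗ[K] M}
    (h : ∀ (a b : V) (p : Path a b), F (ofPath K p) = G (ofPath K p)) : F = G := by
  let F' : (∀ a b : V, Path a b →₀ K) →ₗ[K] M := F
  let G' : (∀ a b : V, Path a b →₀ K) →ₗ[K] M := G
  have h' : F' = G' := LinearMap.pi_ext' fun a => LinearMap.pi_ext' fun b =>
    Finsupp.lhom_ext' fun p => LinearMap.ext_ring (h a b p)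
  exact h'

/-- Linear maps on the truncated algebra are determined by the nonzero paths. -/
theorem truncated_hom_ext {M : Type*} [AddCommGroup M] [Module K M]
    {F G : TruncatedAlgebra K V n →ₗ[K] M}
    (h : ∀ (a b : V) (p : Path a b), p.length < n → F (pathClass K n p) = G (pathClass K n p)) :
    F = G := by
  let Q : PathAlgebra K V →ₗ[K] TruncatedAlgebra K V n :=
    ((pathIdeal K V n).asIdeal.mkQ).restrictScalars K
  have hQ : F ∘ₗ Q = G ∘ₗ Q := pathAlgebra_hom_ext fun a b p => by
    change F (pathClass K n p) = G (pathClass K n p)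
    rcases Nat.lt_or_ge p.length n with hp | hp
    · exact h a b p hp
    · rw [pathClass_of_length_le p hp, map_zero, map_zero]
  refine LinearMap.ext fun x => ?_
  obtain ⟨f, rfl⟩ := Submodule.Quotient.mk_surjective _ x
  exact LinearMap.congr_fun hQ f

end PathClasses

/-! ### Paths in the cyclic quiver -/

section CyclicPaths

variable {s : ℕ}

instance : CommRing (Cyc s) := inferInstanceAs (CommRing (ZMod s))

/-- The path of length `l` from `i` to `j` in the cyclic quiver, where `j = i + l`. -/
def cycPath (i : Cyc s) : ∀ (l : ℕ) (j : Cyc s), j = i + l → Path i j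
  | 0, _, h => (show i = _ by simpa using h.symm) ▸ Path.nil
  | l + 1, j, h => (cycPath i l (j - 1) (by rw [h]; push_cast; ring)).cons
      ⟨show j - 1 + 1 = j by ring⟩

@[simp] theorem length_cycPath (i : Cyc s) (l : ℕ) (j : Cyc s) (h : j = i + l) :
    (cycPath i l j h).length = l := by
  induction l generalizing j with
  | zero =>
    obtain rfl : i = j := by simpa using h.symm
    rfl
  | succ l ih => simp [cycPath, ih]

theorem arrow_target {i j : Cyc s} (e : i ⟶ j) : j = i + 1 := e.down.symm

theorem path_target {i j : Cyc s} (p : Path i j) : j = i + p.length := by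
  induction p with
  | nil => simp
  | cons p e ih =>
    refine (arrow_target e).trans ?_
    rw [Path.length_cons, Nat.cast_succ, ← add_assoc, ← ih]

theorem path_eq_of_length {i j : Cyc s} (p q : Path i j) (h : p.length = q.length) : p = q := by
  induction p with
  | nil =>
    cases q with
    | nil => rfl
    | cons q e => simp at h
  | @cons b c p e ih =>
    cases q with
    | nil => simp at h
    | @cons b' _ q e' =>
      obtain rfl : b = b' := by
        have h1 := arrow_target e
        have h2 := arrow_target e'
        exact add_right_cancel (h1.symm.trans h2)
      obtain ⟨e⟩ := e
      obtain ⟨e'⟩ := e'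
      rw [ih q (by simpa using h)]

end CyclicPaths

/-! ### The path basis of the truncated cycle algebra -/

section CycleBasis

variable {K : Type*} [Field K] {s n : ℕ} [NeZero s]

variable (K n) in
/-- The class in `A` of the path of length `l` that starts at `i`. -/
def pathAt (i : Cyc s) (l : ℕ) : CycleAlgebra K s n := pathClass K n (cycPath i l (i + l) rfl)

theorem pathClass_eq_pathAt {i j : Cyc s} (p : Path i j) :
    pathClass K n p = pathAt K n i p.length := by
  have h := path_target p
  generalize hl : p.length = l at h
  subst h
  rw [pathAt, path_eq_of_length p (cycPath i l _ rfl) (by simpa using hl)]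

theorem pathAt_of_le (i : Cyc s) {l : ℕ} (h : n ≤ l) : pathAt K n i l = 0 :=
  pathClass_of_length_le _ (by simpa using h)

theorem pathAt_mul (i j : Cyc s) (l m : ℕ) :
    pathAt K n i l * pathAt K n j m = if j = i + l then pathAt K n i (l + m) else 0 := by
  split_ifs with h
  · subst h
    rw [pathAt, pathAt, pathClass_mul, pathClass_eq_pathAt]
    simp
  · exact pathClass_mul_of_ne (Ne.symm h) _ _

variable (K n) in
/-- The coefficient of an element of `A` at the path of length `l` that starts at `i`. -/
def coeff (i : Cyc s) (l : ℕ) : CycleAlgebra K s n →ₗ[K] K :=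
  Finsupp.lapply (cycPath i l (i + l) rfl) ∘ₗ component K i (i + l) ∘ₗ normalForm K (Cyc s) n

theorem coeff_pathAt (i j : Cyc s) (l m : ℕ) :
    coeff K n i l (pathAt K n j m) = if i = j ∧ l = m ∧ l < n then 1 else 0 := by
  rcases Nat.lt_or_ge m n with hm | hm
  · have h1 : coeff K n i l (pathAt K n j m) =
        (ofPath K (cycPath j m (j + m) rfl)) i (i + l) (cycPath i l (i + l) rfl) := by
      change (normalForm K (Cyc s) n (pathAt K n j m)) i (i + l) _ = _
      rw [pathAt, normalForm_pathClass _ (by simpa using hm)]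
    rw [h1]
    by_cases hi : i = j
    · subst hi
      by_cases hl : l = m
      · subst hl; simp [ofPath, hm]
      · rw [if_neg (by tauto)]
        have key : ∀ (c d : Cyc s) (p : Path i c) (q : Path i d), q.length ≠ p.length →
            (Pi.single c (Finsupp.single p 1) : ∀ b, Path i b →₀ K) d q = 0 := by
          intro c d p q hpq
          by_cases hcd : d = c
          · subst hcd
            have : p ≠ q := by rintro rfl; exact hpq rfl
            simp [this]
          · simp [hcd]
        rw [ofPath, Pi.single_eq_same]
        exact key _ _ _ _ (by simpa using hl)
    · rw [if_neg (by tauto)]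
      simp [ofPath, hi]
  · rw [pathAt_of_le _ hm, map_zero, if_neg (by omega)]

theorem hom_ext_pathAt {M : Type*} [AddCommGroup M] [Module K M]
    {F G : CycleAlgebra K s n →ₗ[K] M}
    (h : ∀ (i : Cyc s) (l : ℕ), l < n → F (pathAt K n i l) = G (pathAt K n i l)) : F = G :=
  truncated_hom_ext fun a b p hp => by
    rw [pathClass_eq_pathAt]; exact h a _ hp

variable (n) in
/-- The linear map on `A` with prescribed values on the paths of length `< n`. -/
def pathLift {M : Type*} [AddCommGroup M] [Module K M] (c : Cyc s → ℕ → M) :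
    CycleAlgebra K s n →ₗ[K] M :=
  ∑ i, ∑ l ∈ Finset.range n, (coeff K n i l).smulRight (c i l)

theorem pathLift_pathAt {M : Type*} [AddCommGroup M] [Module K M] (c : Cyc s → ℕ → M) (i : Cyc s)
    (l : ℕ) : pathLift n c (pathAt K n i l) = if l < n then c i l else 0 := by
  simp only [pathLift, LinearMap.sum_apply, LinearMap.smulRight_apply, coeff_pathAt]
  rw [Finset.sum_eq_single i]
  · split_ifs with h
    · rw [Finset.sum_eq_single l]
      · simp [h]
      · intro b _ hb; simp [hb]
      · intro hl; simp at hl; omega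
    · refine Finset.sum_eq_zero fun k hk => ?_
      rw [if_neg, zero_smul]
      rintro ⟨-, rfl, h'⟩
      exact h h'
  · intro j _ hj
    simp [hj]
  · simp

theorem eq_sum_coeff_smul_pathAt (a : CycleAlgebra K s n) :
    a = ∑ i, ∑ l ∈ Finset.range n, coeff K n i l a • pathAt K n i l := by
  have h : LinearMap.id = pathLift n (pathAt K n (s := s)) := hom_ext_pathAt fun i l hl => by
    rw [pathLift_pathAt, if_pos hl]; rfl
  have := LinearMap.congr_fun h a
  simpa [pathLift] using this

theorem one_eq_sum : (1 : CycleAlgebra K s n) = ∑ i, pathAt K n i 0 := by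
  -- The sum is a right unit.
  have h : LinearMap.mulRight K (∑ i, pathAt K n i 0) =
      (LinearMap.id : CycleAlgebra K s n →ₗ[K] CycleAlgebra K s n) :=
    hom_ext_pathAt fun i l hl => by
      simp [Finset.mul_sum, pathAt_mul]
  have := LinearMap.congr_fun h 1
  simpa using this.symm

variable (K s n) in
/-- The sum of all arrows. -/
def arrowSum : CycleAlgebra K s n := ∑ i, pathAt K n i 1

theorem pathAt_mul_arrowSum (i : Cyc s) (l : ℕ) :
    pathAt K n i l * arrowSum K s n = pathAt K n i (l + 1) := by
  simp [arrowSum, Finset.mul_sum, pathAt_mul]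

theorem arrowSum_mul_pathAt (i : Cyc s) (l : ℕ) :
    arrowSum K s n * pathAt K n i l = pathAt K n (i - 1) (1 + l) := by
  rw [arrowSum, Finset.sum_mul, Finset.sum_eq_single (i - 1)]
  · simp [pathAt_mul]
  · intro j _ hj
    rw [pathAt_mul, if_neg]
    rintro rfl
    simp at hj
  · simp

theorem pathAt_mul_arrowSum_pow (i : Cyc s) (l m : ℕ) :
    pathAt K n i l * arrowSum K s n ^ m = pathAt K n i (l + m) := by
  induction m with
  | zero => simp
  | succ m ih => rw [pow_succ, ← mul_assoc, ih, pathAt_mul_arrowSum]; rfl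

theorem arrowSum_pow_mul_pathAt (i : Cyc s) (l m : ℕ) :
    arrowSum K s n ^ m * pathAt K n i l = pathAt K n (i - (m : Cyc s)) (m + l) := by
  induction m with
  | zero => simp
  | succ m ih =>
    rw [pow_succ', mul_assoc, ih, arrowSum_mul_pathAt]
    congr 1
    · push_cast; ring
    · ring

theorem arrowSum_pow (m : ℕ) : arrowSum K s n ^ m = ∑ i, pathAt K n i m := by
  rw [← one_mul (arrowSum K s n ^ m), one_eq_sum, Finset.sum_mul]
  simp [pathAt_mul_arrowSum_pow]

theorem arrowSum_pow_of_le {m : ℕ} (h : n ≤ m) : arrowSum K s n ^ m = 0 := by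
  simp [arrowSum_pow, pathAt_of_le _ h]

/-- The coefficients of a product, as for polynomials with twisted coefficients. -/
theorem coeff_mul (a b : CycleAlgebra K s n) (i : Cyc s) {l : ℕ} (hl : l < n) :
    coeff K n i l (a * b) =
      ∑ k ∈ Finset.range (l + 1), coeff K n i k a * coeff K n (i + (k : Cyc s)) (l - k) b := by
  let F : CycleAlgebra K s n →ₗ[K] CycleAlgebra K s n →ₗ[K] K :=
    (LinearMap.mul K _).compr₂ (coeff K n i l)
  let G : CycleAlgebra K s n →ₗ[K] CycleAlgebra K s n →ₗ[K] K :=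
    ∑ k ∈ Finset.range (l + 1),
      (LinearMap.mul K K).compl₁₂ (coeff K n i k) (coeff K n (i + (k : Cyc s)) (l - k))
  suffices h : F = G by
    have := LinearMap.congr_fun (LinearMap.congr_fun h a) b
    simpa [F, G] using this
  refine hom_ext_pathAt fun j m hm => hom_ext_pathAt fun j' m' hm' => ?_
  simp only [F, G, LinearMap.compr₂_apply, LinearMap.mul_apply', LinearMap.sum_apply,
    LinearMap.compl₁₂_apply, coeff_pathAt, pathAt_mul]
  by_cases h : j' = j + m ∧ i = j ∧ l = m + m' ∧ l < n
  · obtain ⟨rfl, rfl, rfl, -⟩ := h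
    rw [if_pos rfl, coeff_pathAt, if_pos ⟨rfl, rfl, hl⟩, Finset.sum_eq_single m]
    · simp [hm, hm']
    · intro k _ hk; simp [hk]
    · simp
  · have h1 : coeff K n i l (if j' = j + m then pathAt K n j (m + m') else 0) = 0 := by
      split_ifs with h'
      · rw [coeff_pathAt, if_neg (by tauto)]
      · simp
    rw [h1, eq_comm]
    refine Finset.sum_eq_zero fun k hk => ?_
    rw [Finset.mem_range] at hk
    by_cases h2 : i = j ∧ k = m ∧ k < n
    · rw [if_neg (show ¬(i + (k : Cyc s) = j' ∧ l - k = m' ∧ l - k < n) from ?_), mul_zero]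
      rintro ⟨h3, h4, -⟩
      exact h ⟨by rw [← h3, h2.1, h2.2.1], h2.1, by omega, hl⟩
    · rw [if_neg h2, zero_mul]

end CycleBasis

/-! ### Values of `Θ` on paths -/

section ThetaOnPaths

variable {K V : Type*} [Field K] [Quiver V] {n q : ℕ}

theorem length_splitPath_fst {a b : V} (p : Path a b) (k : ℕ) :
    (splitPath p k).2.1.length = min k p.length := by
  induction p with
  | nil => simp [splitPath]
  | cons p e ih =>
    rw [splitPath]
    by_cases h : k ≤ p.length
    · rw [if_pos h, ih, Path.length_cons]; omega
    · rw [if_neg h, Path.length_cons]; omega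

theorem length_splitPath_snd {a b : V} (p : Path a b) (k : ℕ) :
    (splitPath p k).2.2.length = p.length - k := by
  induction p with
  | nil => simp [splitPath]
  | cons p e ih =>
    rw [splitPath]
    by_cases h : k ≤ p.length
    · rw [if_pos h, Path.length_cons, ih, Path.length_cons]; omega
    · rw [if_neg h, Path.length_cons, Path.length_nil]; omega

variable (K n q) in
/-- The functional `u ⊗ v ↦ γ i` on the chains, where `i` is the vertex at which `v` starts. -/
def startFunctional (γ : V → K) : Module.Dual K (Chain K V n n q) :=
  Finsupp.linearCombination K fun w => γ w.b

theorem startFunctional_bracket (γ : V → K) {a b : V} (u : Path a b) (v : Path b a) :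
    startFunctional K n q γ (bracket K n n q u v) =
      if u.length < n ∧ v.length = n ∧ u.length + v.length = q then γ b else 0 := by
  unfold bracket
  split_ifs with h <;> simp [startFunctional]

theorem thetaValue_startFunctional (γ : V → K) {a b c : V} (p : Path a b) (p' : Path b c)
    (x : Path c a) :
    thetaValue (startFunctional K n q γ) p p' x =
      if n ≤ p.length + p'.length ∧ p.length + p'.length + x.length = q ∧ q < 2 * n
      then γ a else 0 := by
  unfold thetaValue
  rw [startFunctional_bracket]
  simp only [Path.length_comp, length_splitPath_fst, length_splitPath_snd]
  rw [← ite_and]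
  refine if_congr ?_ rfl rfl
  omega

variable [Fintype V]

theorem component_ofPath {a b : V} (p : Path a b) :
    component K a b (ofPath K p) = Finsupp.single p 1 := by
  change (Pi.single a (Pi.single b (Finsupp.single p 1)) : ∀ a b : V, Path a b →₀ K) a b = _
  simp

theorem component_ofPath_of_ne {a b c d : V} (p : Path a b) (h : ¬(c = a ∧ d = b)) :
    component K c d (ofPath K p) = 0 := by
  change (ofPath K p) c d = 0
  by_cases hc : c = a
  · subst hc
    have hd : d ≠ b := fun hd => h ⟨rfl, hd⟩
    simp [ofPath, hd]
  · simp [ofPath, hc]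

theorem theta_apply (g : Module.Dual K (Chain K V n n q)) (x y z : TruncatedAlgebra K V n) :
    theta g x y z = ∑ a : V, ∑ b : V, ∑ c : V,
      thetaForm g a b c (component K a b (normalForm K V n x))
          (component K b c (normalForm K V n y)) (component K c a (normalForm K V n z)) := by
  simp only [theta, LinearMap.mk₂_apply, D.of_apply, LinearMap.sum_apply, LinearMap.comp_apply]

theorem theta_pathClass (g : Module.Dual K (Chain K V n n q)) {a b c : V} (p : Path a b)
    (p' : Path b c) (x : Path c a) (hp : p.length < n) (hp' : p'.length < n)
    (hx : x.length < n) :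
    theta g (pathClass K n p) (pathClass K n p') (pathClass K n x) = thetaValue g p p' x := by
  rw [theta_apply, normalForm_pathClass p hp, normalForm_pathClass p' hp',
    normalForm_pathClass x hx, Finset.sum_eq_single a, Finset.sum_eq_single b,
    Finset.sum_eq_single c]
  · simp [component_ofPath, thetaForm]
  · intro d _ hd; rw [component_ofPath_of_ne x (by tauto)]; simp
  · simp
  · intro d _ hd
    refine Finset.sum_eq_zero fun _ _ => ?_
    rw [component_ofPath_of_ne p (by tauto)]; simp
  · simp
  · intro d _ hd
    refine Finset.sum_eq_zero fun _ _ => Finset.sum_eq_zero fun _ _ => ?_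
    rw [component_ofPath_of_ne p (by tauto)]; simp
  · simp

theorem theta_pathClass_of_ne (g : Module.Dual K (Chain K V n n q)) {a b b' c c' a' : V}
    (p : Path a b) (p' : Path b' c) (x : Path c' a') (hp : p.length < n) (hp' : p'.length < n)
    (hx : x.length < n) (h : ¬(b' = b ∧ c' = c ∧ a = a')) :
    theta g (pathClass K n p) (pathClass K n p') (pathClass K n x) = 0 := by
  rw [theta_apply, normalForm_pathClass p hp, normalForm_pathClass p' hp',
    normalForm_pathClass x hx]
  refine Finset.sum_eq_zero fun i _ => Finset.sum_eq_zero fun j _ =>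
    Finset.sum_eq_zero fun k _ => ?_
  by_cases h1 : i = a ∧ j = b
  · by_cases h2 : j = b' ∧ k = c
    · have h3 : ¬(k = c' ∧ i = a') := by
        rintro ⟨h3, h4⟩
        exact h ⟨h2.1 ▸ h1.2, h2.2 ▸ h3.symm, h1.1 ▸ h4⟩
      rw [component_ofPath_of_ne x h3]; simp
    · rw [component_ofPath_of_ne p' h2]; simp
  · rw [component_ofPath_of_ne p h1]; simp

end ThetaOnPaths

/-! ### The cocycles `Θ(g)` for the cyclic quiver -/

section ThetaOnCycle

variable {K : Type*} [Field K] {s n q : ℕ} [NeZero s]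

omit [NeZero s] in
theorem cyclePair_ext {m : ℕ} {w w' : CyclePair (Cyc s) n m q} (h : w.b = w'.b) : w = w' := by
  obtain ⟨a, b, u, v, h1, h2, h3⟩ := w
  obtain ⟨a', b', u', v', h1', h2', h3'⟩ := w'
  obtain rfl : b = b' := h
  obtain rfl : a = a' := by rw [path_target v, path_target v', h2, h2']
  obtain rfl : u = u' := path_eq_of_length _ _ (by omega)
  obtain rfl : v = v' := path_eq_of_length _ _ (by omega)
  rfl

omit [NeZero s] in
theorem exists_eq_startFunctional (g : Module.Dual K (Chain K (Cyc s) n n q)) :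
    ∃ γ : Cyc s → K, g = startFunctional K n q γ := by
  refine ⟨fun i => if h : ∃ w : CyclePair (Cyc s) n n q, w.b = i
    then g (Finsupp.single h.choose 1) else 0, ?_⟩
  refine Finsupp.lhom_ext' fun w => LinearMap.ext_ring ?_
  have h : ∃ w' : CyclePair (Cyc s) n n q, w'.b = w.b := ⟨w, rfl⟩
  have hw : h.choose = w := cyclePair_ext h.choose_spec
  simp only [LinearMap.comp_apply, Finsupp.lsingle_apply, startFunctional,
    Finsupp.linearCombination_single, one_smul]
  rw [dif_pos h, hw]

theorem theta_pathAt_of_lt (γ : Cyc s → K) (i j k : Cyc s) {l m r : ℕ} (hl : l < n) (hm : m < n)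
    (hr : r < n) :
    theta (startFunctional K n q γ) (pathAt K n i l) (pathAt K n j m) (pathAt K n k r) =
      if (j = i + (l : Cyc s) ∧ k = j + (m : Cyc s) ∧ i = k + (r : Cyc s)) ∧ n ≤ l + m ∧
        l + m + r = q ∧ q < 2 * n
      then γ i else 0 := by
  by_cases h : j = i + (l : Cyc s) ∧ k = j + (m : Cyc s) ∧ i = k + (r : Cyc s)
  · obtain ⟨rfl, rfl, h3⟩ := h
    have hk : pathAt K n (i + (l : Cyc s) + (m : Cyc s)) r =
        pathClass K n (cycPath (i + (l : Cyc s) + (m : Cyc s)) r i h3) := by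
      rw [pathClass_eq_pathAt]; simp
    rw [hk, pathAt, pathAt, theta_pathClass _ _ _ _ (by simpa) (by simpa) (by simpa),
      thetaValue_startFunctional]
    refine if_congr ?_ rfl rfl
    simp only [length_cycPath]
    tauto
  · rw [if_neg (by tauto)]
    exact theta_pathClass_of_ne _ _ _ _ (by simpa) (by simpa) (by simpa) h

/-- The value of `Θ(g)` on paths; for `q ≥ 2 n` there are no chains and it vanishes. -/
theorem theta_pathAt (γ : Cyc s → K) (i j k : Cyc s) (l m r : ℕ) :
    theta (startFunctional K n q γ) (pathAt K n i l) (pathAt K n j m) (pathAt K n k r) =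
      if (j = i + (l : Cyc s) ∧ k = j + (m : Cyc s) ∧ i = k + (r : Cyc s)) ∧
        (l < n ∧ m < n ∧ r < n) ∧ n ≤ l + m ∧ l + m + r = q ∧ q < 2 * n
      then γ i else 0 := by
  by_cases h : l < n ∧ m < n ∧ r < n
  · rw [theta_pathAt_of_lt γ i j k h.1 h.2.1 h.2.2]
    exact if_congr (by tauto) rfl rfl
  · rw [if_neg (by tauto)]
    by_cases hl : l < n
    · by_cases hm : m < n
      · rw [pathAt_of_le k (l := r) (by omega)]; exact map_zero _
      · rw [pathAt_of_le j (l := m) (by omega), map_zero]; rfl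
    · rw [pathAt_of_le i (l := l) (by omega), map_zero]; rfl

theorem eq_zero_of_pathAt {f : CycleAlgebra K s n → K} (hf : IsLinearMap K f)
    (h : ∀ (i : Cyc s) (l : ℕ), l < n → f (pathAt K n i l) = 0) (a : CycleAlgebra K s n) :
    f a = 0 :=
  LinearMap.congr_fun (hom_ext_pathAt (F := hf.mk' f) (G := 0) h) a

/-- If `γ` is constant, or if `q ≤ n`, then `Θ(g)` is a cocycle. -/
theorem theta_mem_cocycles (γ : Cyc s → K) (hγ : n < q → ∀ i, γ (i + 1) = γ i) :
    theta (startFunctional K n q γ) ∈ cocycles K (CycleAlgebra K s n) := by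
  set α := theta (startFunctional K n q γ) with hα
  have hγ' : n < q → ∀ (i : Cyc s) (l : ℕ), γ (i + (l : Cyc s)) = γ i := by
    intro h i l
    induction l with
    | zero => simp
    | succ l ih => rw [Nat.cast_succ, ← add_assoc, hγ h, ih]
  let E : CycleAlgebra K s n → CycleAlgebra K s n → CycleAlgebra K s n → CycleAlgebra K s n → K :=
    fun a b c x => α b c (x * a) - α (a * b) c x + α a (b * c) x - α a b (c * x)
  have key : ∀ a b c x, E a b c x = 0 := by
    refine fun a b c x => eq_zero_of_pathAt (f := fun a => E a b c x) ⟨?_, ?_⟩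
      (fun i l hl => ?_) a
    · intro a a'; simp [E, mul_add, add_mul]; ring
    · intro r a; simp [E]; ring
    refine eq_zero_of_pathAt (f := fun b => E _ b c x) ⟨?_, ?_⟩ (fun j m hm => ?_) b
    · intro a a'; simp [E, mul_add, add_mul]; ring
    · intro r a; simp [E]; ring
    refine eq_zero_of_pathAt (f := fun c => E _ _ c x) ⟨?_, ?_⟩ (fun k r hr => ?_) c
    · intro a a'; simp [E, mul_add, add_mul]; ring
    · intro r a; simp [E]; ring
    refine eq_zero_of_pathAt (f := fun x => E _ _ _ x) ⟨?_, ?_⟩ (fun h t ht => ?_) x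
    · intro a a'; simp [E, mul_add, add_mul]; ring
    · intro r a; simp [E]; ring
    change α _ _ _ - α _ _ _ + α _ _ _ - α _ _ _ = 0
    have hval := fun i j k l m r => theta_pathAt (q := q) (n := n) γ i j k l m r
    rw [← hα] at hval
    by_cases hC : j = i + (l : Cyc s) ∧ k = j + (m : Cyc s) ∧ h = k + r ∧ i = h + t
    · obtain ⟨h1, h2, h3, h4⟩ := hC
      have hj : j = h + ((t + l : ℕ) : Cyc s) := by rw [h1, h4]; push_cast; ring
      have hk : k = i + ((l + m : ℕ) : Cyc s) := by rw [h2, h1]; push_cast; ring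
      have hh : h = j + ((m + r : ℕ) : Cyc s) := by rw [h3, h2]; push_cast; ring
      have hi : i = k + ((r + t : ℕ) : Cyc s) := by rw [h4, h3]; push_cast; ring
      rw [pathAt_mul, if_pos h4, pathAt_mul, if_pos h1, pathAt_mul, if_pos h2, pathAt_mul,
        if_pos h3, hval, hval, hval, hval]
      simp only [← h1, ← h2, ← h3, ← h4, ← hi, ← hj, ← hk, ← hh, true_and, and_self]
      have hji : n ≤ m + r ∧ m + r + (t + l) = q → γ j = γ i := by
        rintro ⟨h5, h6⟩
        rcases Nat.lt_or_ge n q with h7 | h7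
        · rw [h1]; exact hγ' h7 i l
        · have : l = 0 := by omega
          subst this
          rw [h1]; simp
      split_ifs <;> first | omega | (simp; done) | (rw [hji (by omega)]; ring)
    · -- If the four paths do not form a cycle, all terms vanish.
      have t1 : α (pathAt K n j m) (pathAt K n k r) (pathAt K n h t * pathAt K n i l) = 0 := by
        rw [pathAt_mul]
        split_ifs with h4
        · rw [hval, if_neg]
          rintro ⟨⟨h2, h3, h5⟩, -⟩
          exact hC ⟨by rw [h5, h4]; push_cast; ring, h2, h3, h4⟩
        · exact map_zero _
      have t2 : α (pathAt K n i l * pathAt K n j m) (pathAt K n k r) (pathAt K n h t) = 0 := by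
        rw [pathAt_mul]
        split_ifs with h1
        · rw [hval, if_neg]
          rintro ⟨⟨h2, h3, h5⟩, -⟩
          exact hC ⟨h1, by rw [h2, h1]; push_cast; ring, h3, h5⟩
        · simp
      have t3 : α (pathAt K n i l) (pathAt K n j m * pathAt K n k r) (pathAt K n h t) = 0 := by
        rw [pathAt_mul]
        split_ifs with h2
        · rw [hval, if_neg]
          rintro ⟨⟨h1, h3, h5⟩, -⟩
          exact hC ⟨h1, h2, by rw [h3, h2]; push_cast; ring, h5⟩
        · simp
      have t4 : α (pathAt K n i l) (pathAt K n j m) (pathAt K n k r * pathAt K n h t) = 0 := by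
        rw [pathAt_mul]
        split_ifs with h3
        · rw [hval, if_neg]
          rintro ⟨⟨h1, h2, h5⟩, -⟩
          exact hC ⟨h1, h2, h3, by rw [h5, h3]; push_cast; ring⟩
        · exact map_zero _
      rw [t1, t2, t3, t4]; ring
  intro a b c
  ext x
  simpa using key a b c x

end ThetaOnCycle

/-! ### Functionals on the second Hochschild homology -/

section ThetaImage

variable {K : Type*} [Field K] {s n q : ℕ} [NeZero s]

omit [NeZero s] in
theorem startFunctional_d₃ (γ : Cyc s → K) (w : CyclePair (Cyc s) n (n + 1) q) :
    startFunctional K n q γ (d₃ K (Cyc s) n q (Finsupp.single w 1)) =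
      if w.u.length + 1 < n then γ (w.b + 1) - γ w.b else 0 := by
  have hv := w.length_v
  have ht := w.total
  have h1 : (splitPath w.v 1).1 = w.b + 1 := by
    have h := path_target (splitPath w.v 1).2.1
    rw [length_splitPath_fst, hv, min_eq_left (by omega), Nat.cast_one] at h
    exact h
  rw [d₃, Finsupp.linearCombination_single, one_smul, map_sub, startFunctional_bracket,
    startFunctional_bracket]
  simp only [Path.length_comp, length_splitPath_fst, length_splitPath_snd, hv]
  by_cases h : w.u.length + 1 < n
  · rw [if_pos h, if_pos (by omega), if_pos (by omega), h1]
  · rw [if_neg h, if_neg (by omega), if_neg (by omega), sub_zero]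

/-- The classes of the cocycles `Θ(g)` in degree `n`, or with constant coefficients. -/
theorem cls_theta_mem_thetaImage (γ : Cyc s → K) (hγ : n < q → ∀ i, γ (i + 1) = γ i) :
    cls ⟨theta (startFunctional K n q γ), theta_mem_cocycles γ hγ⟩ ∈
      thetaImage K (Cyc s) n q := by
  have hker : LinearMap.range (d₃ K (Cyc s) n q) ≤ LinearMap.ker (startFunctional K n q γ) := by
    rw [LinearMap.range_le_ker_iff]
    refine Finsupp.lhom_ext' fun w => LinearMap.ext_ring ?_
    have hw := w.total
    have hv := w.length_v
    change startFunctional K n q γ (d₃ K (Cyc s) n q (Finsupp.single w 1)) = 0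
    rw [startFunctional_d₃]
    split_ifs
    · rw [hγ (by omega), sub_self]
    · rfl
  exact ⟨(Submodule.liftQ _ _ hker) ∘ₗ Submodule.subtype _, startFunctional K n q γ, _,
    fun z => rfl, rfl, rfl⟩

omit [NeZero s] in
theorem d₂_eq_zero (hq : n < q) : d₂ K (Cyc s) n q = 0 := by
  refine Finsupp.lhom_ext' fun w => LinearMap.ext_ring ?_
  change d₂ K (Cyc s) n q (Finsupp.single w 1) = 0
  rw [d₂, Finsupp.linearCombination_single, one_smul]
  refine Finset.sum_eq_zero fun j _ => ?_
  rw [bracket, dif_neg]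
  omega

/-- In degrees above `n`, functionals on homology are constant on the chain basis. -/
theorem exists_const_of_mem_thetaImage (hq : n < q) (hq' : q < 2 * n)
    {c : Cohomology₂ K (CycleAlgebra K s n)} (hc : c ∈ thetaImage K (Cyc s) n q) :
    ∃ (γ : Cyc s → K) (δ : cocycles K (CycleAlgebra K s n)),
      δ.1 = theta (startFunctional K n q γ) ∧ c = cls δ ∧
        ((q : Cyc s) = 0 → ∀ i, γ (i + 1) = γ i) := by
  obtain ⟨f, g, δ, hfg, hδ, rfl⟩ := hc
  obtain ⟨γ, rfl⟩ := exists_eq_startFunctional g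
  refine ⟨γ, δ, hδ, rfl, fun hs i => ?_⟩
  have hcast : i = i + ((n + 1 : ℕ) : Cyc s) + ((q - (n + 1) : ℕ) : Cyc s) := by
    rw [add_assoc, ← Nat.cast_add, show n + 1 + (q - (n + 1)) = q by omega, hs, add_zero]
  let w : CyclePair (Cyc s) n (n + 1) q :=
    { a := i + ((n + 1 : ℕ) : Cyc s)
      b := i
      u := cycPath _ (q - (n + 1)) _ hcast
      v := cycPath _ (n + 1) _ rfl
      short := by rw [length_cycPath]; omega
      length_v := by rw [length_cycPath]
      total := by rw [length_cycPath, length_cycPath]; omega }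
  have hz : d₃ K (Cyc s) n q (Finsupp.single w 1) ∈ LinearMap.ker (d₂ K (Cyc s) n q) := by
    rw [d₂_eq_zero hq]; simp
  have h0 : homologyClass K (Cyc s) n q ⟨_, hz⟩ = 0 := by
    refine Subtype.ext ?_
    exact (Submodule.Quotient.mk_eq_zero _).2 ⟨_, rfl⟩
  have h := hfg ⟨_, hz⟩
  rw [h0, map_zero, startFunctional_d₃, if_pos] at h
  · exact sub_eq_zero.1 h
  · change (cycPath _ (q - (n + 1)) _ hcast).length + 1 < n
    rw [length_cycPath]; omega

/-- Only the top degree pairs with the paths of length `n - 1`. -/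
theorem theta_socle (hq : q ≠ 2 * n - 1) (γ : Cyc s → K) (x y : CycleAlgebra K s n) (k : Cyc s) :
    theta (startFunctional K n q γ) x y (pathAt K n k (n - 1)) = 0 := by
  refine eq_zero_of_pathAt (f := fun x => theta (startFunctional K n q γ) x y _) ⟨?_, ?_⟩
    (fun i l hl => ?_) x
  · intro a a'; simp
  · intro r a; simp
  refine eq_zero_of_pathAt (f := fun y => theta (startFunctional K n q γ) _ y _) ⟨?_, ?_⟩
    (fun j m hm => ?_) y
  · intro a a'; simp
  · intro r a; simp
  rw [theta_pathAt, if_neg]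
  omega

theorem theta_arrowSum_socle (hn : 2 ≤ n) (hs : ((2 * n - 1 : ℕ) : Cyc s) = 0) (γ : Cyc s → K)
    (k : Cyc s) :
    theta (startFunctional K n (2 * n - 1) γ) (arrowSum K s n ^ (n - 1)) (arrowSum K s n)
      (pathAt K n k (n - 1)) = γ (k - (n : Cyc s)) := by
  have hsum : ∀ (t : Finset (Cyc s)) (f : Cyc s → D K (CycleAlgebra K s n)) z,
      (∑ i ∈ t, f i) z = ∑ i ∈ t, f i z := fun t f z => LinearMap.sum_apply _ _ _
  have hn1 : ∀ i : Cyc s, i + ((n - 1 : ℕ) : Cyc s) + ((1 : ℕ) : Cyc s) = i + (n : Cyc s) :=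
    fun i => by rw [add_assoc, ← Nat.cast_add, Nat.sub_add_cancel (by omega)]
  -- The only composable terms start at `k - n`.
  have hterm : ∀ i j, theta (startFunctional K n (2 * n - 1) γ) (pathAt K n i (n - 1))
      (pathAt K n j 1) (pathAt K n k (n - 1)) =
        if j = k - (n : Cyc s) + ((n - 1 : ℕ) : Cyc s) then
          if i = k - (n : Cyc s) then γ i else 0 else 0 := by
    intro i j
    rw [theta_pathAt, ← ite_and]
    refine if_congr ?_ rfl rfl
    constructor
    · rintro ⟨⟨h1, h2, -⟩, -⟩
      have hi : i = k - (n : Cyc s) := by rw [h2, h1, hn1]; ring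
      exact ⟨by rw [← hi, h1], hi⟩
    · rintro ⟨h1, h2⟩
      refine ⟨⟨by rw [h1, h2], ?_, ?_⟩, by omega, by omega, by omega, by omega⟩
      · rw [h1, hn1]; ring
      · rw [h2, sub_eq_iff_eq_add, add_assoc, ← Nat.cast_add, show n - 1 + n = 2 * n - 1 by omega,
          hs, add_zero]
  rw [arrowSum_pow, arrowSum, map_sum, hsum]
  simp only [map_sum, LinearMap.sum_apply, hsum, hterm]
  simp

theorem cochain_ext {α β : Cochain₂ K (CycleAlgebra K s n)}
    (h : ∀ (i j k : Cyc s) (l m r : ℕ), l < n → m < n → r < n →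
      α (pathAt K n i l) (pathAt K n j m) (pathAt K n k r) =
        β (pathAt K n i l) (pathAt K n j m) (pathAt K n k r)) : α = β := by
  refine hom_ext_pathAt fun i l hl => hom_ext_pathAt fun j m hm => ?_
  exact (D.of K _).symm.injective (hom_ext_pathAt fun k r hr => h i j k l m r hl hm hr)

theorem theta_eq_zero (γ : Cyc s → K) (hγ : (q : Cyc s) = 0 → ∀ i, γ i = 0) :
    theta (startFunctional K n q γ) = 0 := by
  refine cochain_ext fun i j k l m r _ _ _ => ?_
  rw [theta_pathAt]
  split_ifs with h
  · obtain ⟨⟨h1, h2, h3⟩, -, -, h4, -⟩ := h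
    refine hγ ?_ i
    have h5 : i + (q : Cyc s) = i := by
      conv_rhs => rw [h3, h2, h1]
      rw [← h4]
      push_cast
      ring
    simpa using h5
  · rfl

end ThetaImage

/-! ### The quiver of a Hochschild extension -/

section QuiverOfExtension

variable {K : Type*} [Field K] {s n : ℕ} [NeZero s]

theorem coeff_ext {a b : CycleAlgebra K s n}
    (h : ∀ i l, l < n → coeff K n i l a = coeff K n i l b) : a = b := by
  rw [eq_sum_coeff_smul_pathAt a, eq_sum_coeff_smul_pathAt b]
  exact Finset.sum_congr rfl fun i _ => Finset.sum_congr rfl fun l hl => by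
    rw [h i l (Finset.mem_range.1 hl)]

theorem coeff_pow_eq_zero {a : CycleAlgebra K s n} (ha : ∀ i, coeff K n i 0 a = 0) (k : ℕ) :
    ∀ i l, l < n → l < k → coeff K n i l (a ^ k) = 0 := by
  induction k with
  | zero => intro i l _ h; omega
  | succ k ih =>
    intro i l hl hlk
    rw [pow_succ', coeff_mul _ _ _ hl]
    refine Finset.sum_eq_zero fun m hm => ?_
    rw [Finset.mem_range] at hm
    rcases Nat.eq_zero_or_pos m with rfl | h
    · rw [ha, zero_mul]
    · rw [ih _ _ (by omega) (by omega), mul_zero]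

variable (n) in
/-- Removing the last arrow of a path. -/
def dropLast : CycleAlgebra K s n →ₗ[K] CycleAlgebra K s n :=
  pathLift n fun i l => if l = 0 then 0 else pathAt K n i (l - 1)

theorem dropLast_mul_arrowSum {a : CycleAlgebra K s n} (ha : ∀ i, coeff K n i 0 a = 0) :
    dropLast n a * arrowSum K s n = a := by
  have h : LinearMap.mulRight K (arrowSum K s n) ∘ₗ dropLast n +
      pathLift n (fun i l => if l = 0 then pathAt K n i 0 else 0) = LinearMap.id := by
    refine hom_ext_pathAt fun i l hl => ?_
    simp only [LinearMap.add_apply, LinearMap.comp_apply, dropLast, pathLift_pathAt, if_pos hl,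
      LinearMap.mulRight_apply, LinearMap.id_apply]
    rcases Nat.eq_zero_or_pos l with rfl | h
    · simp
    · rw [if_neg (by omega), if_neg (by omega), pathAt_mul_arrowSum,
        Nat.sub_add_cancel (by omega), add_zero]
  have h0 : pathLift n (fun i l => if l = 0 then pathAt K n i 0 else 0) a = 0 := by
    simp only [pathLift, LinearMap.sum_apply, LinearMap.smulRight_apply]
    refine Finset.sum_eq_zero fun i _ => Finset.sum_eq_zero fun l _ => ?_
    split_ifs with hl
    · rw [hl, ha, zero_smul]
    · rw [smul_zero]
  have h' := LinearMap.congr_fun h a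
  simpa [h0] using h'

theorem coeff_dropLast (a : CycleAlgebra K s n) (i : Cyc s) :
    coeff K n i 0 (dropLast n a) = coeff K n i 1 a := by
  have h : coeff K n i 0 ∘ₗ dropLast n = coeff K n i 1 := by
    refine hom_ext_pathAt fun j l hl => ?_
    simp only [LinearMap.comp_apply, dropLast, pathLift_pathAt, if_pos hl]
    split_ifs with h
    · subst h; simp [coeff_pathAt]
    · rw [coeff_pathAt, coeff_pathAt]
      refine if_congr ?_ rfl rfl
      constructor <;> rintro ⟨h1, h2, h3⟩ <;> exact ⟨h1, by omega, by omega⟩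
  exact LinearMap.congr_fun h a

theorem pathAt_socle_mul (hn : 0 < n) (k : Cyc s) (x : CycleAlgebra K s n) :
    pathAt K n k (n - 1) * x =
      coeff K n (k + ((n - 1 : ℕ) : Cyc s)) 0 x • pathAt K n k (n - 1) := by
  have h : LinearMap.mulLeft K (pathAt K n k (n - 1)) =
      (coeff K n (k + ((n - 1 : ℕ) : Cyc s)) 0).smulRight (pathAt K n k (n - 1)) := by
    refine hom_ext_pathAt fun j l hl => ?_
    simp only [LinearMap.mulLeft_apply, LinearMap.smulRight_apply, pathAt_mul, coeff_pathAt]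
    rcases Nat.eq_zero_or_pos l with rfl | h
    · by_cases hj : j = k + ((n - 1 : ℕ) : Cyc s)
      · rw [if_pos hj, if_pos ⟨hj.symm, rfl, hn⟩, one_smul, add_zero]
      · rw [if_neg hj, if_neg (fun h => hj h.1.symm), zero_smul]
    · rw [pathAt_of_le _ (l := n - 1 + l) (by omega), ite_self,
        if_neg (by rintro ⟨-, h', -⟩; omega), zero_smul]
  exact LinearMap.congr_fun h x

theorem mul_pathAt_socle (hn : 0 < n) (k : Cyc s) (x : CycleAlgebra K s n) :
    x * pathAt K n k (n - 1) = coeff K n k 0 x • pathAt K n k (n - 1) := by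
  have h : LinearMap.mulRight K (pathAt K n k (n - 1)) =
      (coeff K n k 0).smulRight (pathAt K n k (n - 1)) := by
    refine hom_ext_pathAt fun j l hl => ?_
    simp only [LinearMap.mulRight_apply, LinearMap.smulRight_apply, pathAt_mul, coeff_pathAt]
    rcases Nat.eq_zero_or_pos l with rfl | h
    · by_cases hj : k = j
      · simp [hj, hn]
      · simp [hj]
    · rw [pathAt_of_le _ (l := l + (n - 1)) (by omega), ite_self,
        if_neg (by rintro ⟨-, h', -⟩; omega), zero_smul]
  exact LinearMap.congr_fun h x

variable {α : cocycles K (CycleAlgebra K s n)}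

variable (α) in
/-- The projection of a Hochschild extension onto the algebra. -/
def extFst : Ext α →ₐ[K] CycleAlgebra K s n :=
  AlgHom.ofLinearMap
    { toFun := fun t => t.1, map_add' := fun _ _ => rfl, map_smul' := fun _ _ => rfl }
    rfl fun _ _ => rfl

@[simp] theorem extFst_apply (t : Ext α) : extFst α t = t.1 := rfl

/-- An element of the algebra as an element of the extension, with zero second component. -/
def extInl (a : CycleAlgebra K s n) : Ext α := (a, 0)

/-- A functional as an element of the extension. -/
def extInr (f : D K (CycleAlgebra K s n)) : Ext α := (0, f)

@[simp] theorem extInl_fst (a : CycleAlgebra K s n) : (extInl a : Ext α).1 = a := rfl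
@[simp] theorem extInl_snd (a : CycleAlgebra K s n) : (extInl a : Ext α).2 = 0 := rfl
@[simp] theorem extInr_fst (f : D K (CycleAlgebra K s n)) : (extInr f : Ext α).1 = 0 := rfl
@[simp] theorem extInr_snd (f : D K (CycleAlgebra K s n)) : (extInr f : Ext α).2 = f := rfl

theorem mul_self_eq_zero_of_fst {t : Ext α} (ht : t.1 = 0) : t * t = 0 :=
  Ext.ext_iff' (by simp [ht]) fun x => by simp [ht]

theorem isNilpotent_of_fst {t : Ext α} (ht : t.1 = 0) : IsNilpotent t :=
  ⟨2, by rw [pow_two, mul_self_eq_zero_of_fst ht]⟩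

variable (α) in
/-- The coefficients at the vertices. -/
def vertexHom (hn : 2 ≤ n) : Ext α →ₐ[K] (Cyc s → K) :=
  (AlgHom.ofLinearMap (LinearMap.pi fun i => coeff K n i 0)
    (by
      ext i
      simp only [LinearMap.pi_apply, one_eq_sum, map_sum, coeff_pathAt, Pi.one_apply]
      rw [Finset.sum_eq_single i] <;> simp +contextual [eq_comm]; omega)
    (fun a b => by
      ext i
      simp [coeff_mul a b i (show 0 < n by omega)])).comp (extFst α)

theorem vertexHom_apply (hn : 2 ≤ n) (t : Ext α) (i : Cyc s) :
    vertexHom α hn t i = coeff K n i 0 t.1 := rfl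

theorem vertexHom_surjective (hn : 2 ≤ n) : Function.Surjective (vertexHom α hn) := by
  intro c
  refine ⟨extInl (∑ i, c i • pathAt K n i 0), ?_⟩
  ext i
  rw [vertexHom_apply, extInl_fst, map_sum, Finset.sum_eq_single i]
  · simp [coeff_pathAt]; omega
  · intro j _ hj; simp [coeff_pathAt, Ne.symm hj]
  · simp

theorem isNilpotent_of_vertexHom (hn : 2 ≤ n) (t : Ext α) (ht : vertexHom α hn t = 0) :
    IsNilpotent t := by
  have h : (t ^ n).1 = 0 := by
    change extFst α (t ^ n) = 0
    rw [map_pow]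
    exact coeff_ext fun i l hl =>
      (coeff_pow_eq_zero (fun i => congrFun ht i) n i l hl hl).trans (map_zero _).symm
  exact IsNilpotent.of_pow (isNilpotent_of_fst h)

theorem mul_mem_radical_sq (hn : 2 ≤ n) {t u : Ext α} (ht : vertexHom α hn t = 0)
    (hu : vertexHom α hn u = 0) :
    t * u ∈ radical K (Ext α) * radical K (Ext α) := by
  have h := mem_radical_iff (K := K) (vertexHom_surjective (α := α) hn)
    (isNilpotent_of_vertexHom hn)
  exact Submodule.mul_mem_mul ((h _).2 ht) ((h _).2 hu)

theorem vertexHom_extInr (hn : 2 ≤ n) (f : D K (CycleAlgebra K s n)) :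
    vertexHom α hn (extInr f) = 0 := by
  ext i; simp [vertexHom_apply]

theorem vertexHom_arrowSum (hn : 2 ≤ n) : vertexHom α hn (extInl (arrowSum K s n)) = 0 := by
  ext i; simp [vertexHom_apply, arrowSum, coeff_pathAt]

/-- A functional that vanishes on the paths of length `n - 1` is of the form `X h`, where `X` is
the sum of the arrows. -/
theorem extInr_mem_radical_sq (hn : 2 ≤ n) {f : D K (CycleAlgebra K s n)}
    (hf : ∀ k, f (pathAt K n k (n - 1)) = 0) :
    (extInr f : Ext α) ∈ radical K (Ext α) * radical K (Ext α) := by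
  let h : D K (CycleAlgebra K s n) :=
    D.of K _ (pathLift n fun i l => if l = 0 then 0 else f (pathAt K n i (l - 1)))
  have hfh : (extInr f : Ext α) = extInl (arrowSum K s n) * extInr h := by
    refine Ext.ext_iff' (by simp) fun x => ?_
    have hl : (D.of K _).symm f = (D.of K _).symm (lact (arrowSum K s n) h) := by
      refine hom_ext_pathAt fun i l hl => ?_
      change f (pathAt K n i l) = h (pathAt K n i l * arrowSum K s n)
      rw [pathAt_mul_arrowSum, D.of_apply, pathLift_pathAt]
      by_cases h1 : l + 1 < n
      · rw [if_pos h1, if_neg (by omega), Nat.add_sub_cancel]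
      · rw [if_neg h1, show l = n - 1 by omega, hf]
    have hx : f x = h (x * arrowSum K s n) := LinearMap.congr_fun hl x
    simpa using hx
  rw [hfh]
  exact mul_mem_radical_sq hn (vertexHom_arrowSum hn) (vertexHom_extInr hn h)

/-- Modulo `J²`, an element of the radical with no component along the arrows is a functional. -/
theorem exists_sub_extInr_mem_radical_sq (hn : 2 ≤ n) {t : Ext α} (ht : vertexHom α hn t = 0)
    (ht' : ∀ k, coeff K n k 1 t.1 = 0) :
    ∃ f, t - extInr f ∈ radical K (Ext α) * radical K (Ext α) := by
  let u : Ext α := extInl (dropLast n t.1) * extInl (arrowSum K s n)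
  refine ⟨t.2 - u.2, ?_⟩
  have h : t - extInr (t.2 - u.2) = u := by
    have h1 : u.1 = t.1 := dropLast_mul_arrowSum fun i => congrFun ht i
    rw [sub_eq_iff_eq_add]
    refine Ext.ext_iff' (by simp [h1]) fun x => ?_
    rw [Ext.add_snd, extInr_snd]
    simp
  rw [h]
  refine mul_mem_radical_sq hn ?_ (vertexHom_arrowSum hn)
  ext i
  rw [vertexHom_apply, extInl_fst, coeff_dropLast, ht']; rfl

theorem coeff_one_mul (hn : 2 ≤ n) (a b : CycleAlgebra K s n) (k : Cyc s) :
    coeff K n k 1 (a * b) =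
      coeff K n k 0 a * coeff K n k 1 b + coeff K n k 1 a * coeff K n (k + 1) 0 b := by
  rw [coeff_mul a b k (show 1 < n by omega), Finset.sum_range_succ, Finset.sum_range_one]
  simp

theorem coeff_sum_smul_pathAt (hn : 2 ≤ n) (c : Cyc s → K) (k : Cyc s) (l : ℕ) :
    coeff K n k l (∑ i, c i • pathAt K n i 1) = if l = 1 then c k else 0 := by
  rw [map_sum, Finset.sum_eq_single k]
  · simp only [map_smul, coeff_pathAt, true_and, smul_eq_mul, mul_ite, mul_one, mul_zero]
    exact if_congr (by omega) rfl rfl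
  · intro j _ hj; simp [coeff_pathAt, Ne.symm hj]
  · simp

/-- If the cocycle has a nonzero constant value in top degree, then the functionals lie in the
square of the radical, and only the arrows of the cyclic quiver remain. -/
theorem hasOrdinaryQuiver_cyclic (hn : 2 ≤ n) {G : K} (hG : G ≠ 0)
    (hα : ∀ k, α.1 (arrowSum K s n ^ (n - 1)) (arrowSum K s n) (pathAt K n k (n - 1)) = G) :
    HasOrdinaryQuiver K (Ext α) (cyclicQuiver s) := by
  have hD : ∀ f, (extInr f : Ext α) ∈ radical K (Ext α) * radical K (Ext α) := by
    intro f
    -- The product of `X ^ (n - 1)` and `X` is a functional that is nonzero on the socle.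
    let c : CycleAlgebra K s n := ∑ i, (G⁻¹ * f (pathAt K n i (n - 1))) • pathAt K n i 0
    let u : Ext α := extInl (arrowSum K s n ^ (n - 1)) * (extInl (arrowSum K s n) * extInl c)
    have hu : u ∈ radical K (Ext α) * radical K (Ext α) := by
      refine mul_mem_radical_sq hn ?_ (by rw [map_mul, vertexHom_arrowSum, zero_mul])
      ext i
      rw [vertexHom_apply, extInl_fst, arrowSum_pow, map_sum]
      refine Finset.sum_eq_zero fun j _ => ?_
      rw [coeff_pathAt, if_neg]
      rintro ⟨-, h, -⟩
      omega
    have hu' : u = (extInl (arrowSum K s n ^ (n - 1)) * extInl (arrowSum K s n)) * extInl c :=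
      (mul_assoc _ _ _).symm
    have hpow : arrowSum K s n ^ (n - 1) * arrowSum K s n = 0 := by
      rw [← pow_succ, Nat.sub_add_cancel (by omega), arrowSum_pow_of_le le_rfl]
    have hu1 : u.1 = 0 := by
      rw [hu']; simp [hpow]
    have hu2 : ∀ k, u.2 (pathAt K n k (n - 1)) = f (pathAt K n k (n - 1)) := by
      intro k
      have hc : coeff K n k 0 c = G⁻¹ * f (pathAt K n k (n - 1)) := by
        rw [map_sum, Finset.sum_eq_single k]
        · simp [coeff_pathAt]; omega
        · intro j _ hj; simp [coeff_pathAt, Ne.symm hj]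
        · simp
      rw [hu']
      simp [hpow, mul_pathAt_socle (show 0 < n by omega), hc, hα]
      field_simp
    have hsub : (extInr f : Ext α) = u + extInr (f - u.2) := by
      refine Ext.ext_iff' (by simp [hu1]) fun x => ?_
      simp
    rw [hsub]
    exact add_mem hu (extInr_mem_radical_sq hn fun k => by simp [hu2])
  refine hasOrdinaryQuiver_of_arrows (χ := vertexHom α hn)
    (Φ := LinearMap.pi (fun k => coeff K n k 1) ∘ₗ (extFst α).toLinearMap)
    (src := id) (tgt := fun k => k + 1) (vertexHom_surjective hn) (isNilpotent_of_vertexHom hn)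
    (fun t u k => ?_) (fun t ht ht' => ?_) (fun c => ?_) _ (fun i j => ⟨?_⟩)
  · exact coeff_one_mul hn t.1 u.1 k
  · obtain ⟨f, hf⟩ := exists_sub_extInr_mem_radical_sq hn ht fun k => congrFun ht' k
    have := add_mem hf (hD f)
    rwa [sub_add_cancel] at this
  · refine ⟨extInl (∑ i, c i • pathAt K n i 1), ?_, ?_⟩
    · ext k
      rw [vertexHom_apply, extInl_fst, coeff_sum_smul_pathAt hn]; simp
    · ext k
      change coeff K n k 1 (∑ i, c i • pathAt K n i 1) = _
      rw [coeff_sum_smul_pathAt hn]; simp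
  · exact
      { toFun := fun w => ⟨by obtain ⟨w, rfl, h⟩ := w; exact h⟩
        invFun := fun e => ⟨i, rfl, e.down⟩
        left_inv := fun w => by obtain ⟨w, rfl, h⟩ := w; rfl
        right_inv := fun e => rfl }

/-- The quiver of the trivial extension: the cyclic quiver together with an arrow
`k + (n - 1) → k` for each vertex `k`, dual to the path of length `n - 1` from `k`. -/
abbrev trivialExtensionQuiver (s n : ℕ) : Quiver.{0} (Cyc s) :=
  ⟨fun i j => {w : Cyc s ⊕ Cyc s //
    Sum.elim id (fun k => k + ((n - 1 : ℕ) : Cyc s)) w = i ∧ Sum.elim (fun k => k + 1) id w = j}⟩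

/-- If the cocycle agrees with a coboundary on the paths of length `n - 1`, then the extension has
the quiver of the trivial extension. -/
theorem hasOrdinaryQuiver_trivialExtension (hn : 2 ≤ n)
    (φ : CycleAlgebra K s n →ₗ[K] D K (CycleAlgebra K s n))
    (hα : ∀ x y k, α.1 x y (pathAt K n k (n - 1)) =
      φ y (pathAt K n k (n - 1) * x) - φ (x * y) (pathAt K n k (n - 1)) +
        φ x (y * pathAt K n k (n - 1))) :
    HasOrdinaryQuiver K (Ext α) (trivialExtensionQuiver s n) := by
  have hn0 : 0 < n := by omega
  let Φ : Ext α →ₗ[K] (Cyc s ⊕ Cyc s → K) :=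
    { toFun := fun t => Sum.elim (fun k => coeff K n k 1 t.1)
        (fun k => t.2 (pathAt K n k (n - 1)) + φ t.1 (pathAt K n k (n - 1)))
      map_add' := fun t u => by
        ext (k | k)
        · simp
        · simp; ring
      map_smul' := fun r t => by
        ext (k | k)
        · simp
        · simp; ring }
  have hΦl : ∀ t k, Φ t (Sum.inl k) = coeff K n k 1 t.1 := fun _ _ => rfl
  have hΦr : ∀ t k, Φ t (Sum.inr k) =
    t.2 (pathAt K n k (n - 1)) + φ t.1 (pathAt K n k (n - 1)) := fun _ _ => rfl
  have hder : ∀ t u w, Φ (t * u) w =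
      vertexHom α hn t (Sum.elim id (fun k => k + ((n - 1 : ℕ) : Cyc s)) w) * Φ u w +
        Φ t w * vertexHom α hn u (Sum.elim (fun k => k + 1) id w) := by
    rintro t u (k | k)
    · exact coeff_one_mul hn t.1 u.1 k
    · rw [hΦr, hΦr, hΦr, vertexHom_apply, vertexHom_apply]
      simp only [Ext.mul_snd, Ext.mul_fst, D.add_apply, lact_apply, ract_apply, hα,
        pathAt_socle_mul hn0, mul_pathAt_socle hn0, map_smul, Sum.elim_inr, id_eq, smul_eq_mul]
      ring
  have hrad := mem_radical_iff (K := K) (vertexHom_surjective (α := α) hn)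
    (isNilpotent_of_vertexHom hn)
  have hΦsq : ∀ t ∈ radical K (Ext α) * radical K (Ext α), Φ t = 0 := by
    intro t ht
    induction ht using Submodule.mul_induction_on' with
    | mem_mul_mem t ht u hu =>
      rw [hrad] at ht hu
      ext w
      simp [hder, ht, hu]
    | add t _ u _ ht hu => rw [map_add, ht, hu, add_zero]
  refine hasOrdinaryQuiver_of_arrows (χ := vertexHom α hn) (Φ := Φ)
    (src := Sum.elim id (fun k => k + ((n - 1 : ℕ) : Cyc s))) (tgt := Sum.elim (fun k => k + 1) id)
    (vertexHom_surjective hn) (isNilpotent_of_vertexHom hn)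
    hder (fun t ht ht' => ?_) (fun c => ?_) _ (fun i j => ⟨Equiv.refl _⟩)
  · obtain ⟨f, hf⟩ := exists_sub_extInr_mem_radical_sq hn ht fun k => congrFun ht' (Sum.inl k)
    have hf' : Φ (extInr f) = 0 := by
      have := hΦsq _ hf
      rw [map_sub, ht', zero_sub, neg_eq_zero] at this
      exact this
    have := add_mem hf (extInr_mem_radical_sq hn fun k => by
      have := congrFun hf' (Sum.inr k)
      rw [hΦr] at this
      simpa using this)
    rwa [sub_add_cancel] at this
  · let a : CycleAlgebra K s n := ∑ i, c (Sum.inl i) • pathAt K n i 1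
    let f : D K (CycleAlgebra K s n) :=
      D.of K _ (pathLift n fun k _ => c (Sum.inr k) - φ a (pathAt K n k (n - 1)))
    refine ⟨extInl a + extInr f, ?_, ?_⟩
    · ext k
      rw [vertexHom_apply, Ext.add_fst, extInl_fst, extInr_fst, add_zero,
        coeff_sum_smul_pathAt hn]; simp
    · ext (k | k)
      · rw [hΦl, Ext.add_fst, extInl_fst, extInr_fst, add_zero, coeff_sum_smul_pathAt hn]; simp
      · rw [hΦr, Ext.add_fst, extInl_fst, extInr_fst, add_zero, Ext.add_snd, extInl_snd,
          extInr_snd, zero_add, D.of_apply, pathLift_pathAt, if_pos (by omega)]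
        ring

end QuiverOfExtension

/-! ### Decomposition of cocycles -/

section Decomposition

variable {K : Type*} [Field K] {s n : ℕ} [NeZero s] {α : cocycles K (CycleAlgebra K s n)}

theorem snd_mul_of_fst_left {A : Type*} [Ring A] [Algebra K A] {α : cocycles K A} {t u : Ext α}
    (ht : t.1 = 0) (x : A) : (t * u).2 x = t.2 (u.1 * x) := by
  simp [ht]

theorem snd_mul_of_fst_right {A : Type*} [Ring A] [Algebra K A] {α : cocycles K A} {t u : Ext α}
    (hu : u.1 = 0) (x : A) : (t * u).2 x = u.2 (x * t.1) := by
  simp [hu]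

theorem completeOrthogonalIdempotents_pathAt :
    CompleteOrthogonalIdempotents fun i => pathAt K n (s := s) i 0 := by
  refine ⟨⟨fun i => ?_, fun i j hij => ?_⟩, one_eq_sum.symm⟩
  · simp [IsIdempotentElem, pathAt_mul]
  · simp [pathAt_mul, Ne.symm hij]

/-- Lifts of the vertices to orthogonal idempotents of the extension, and of the sum of the arrows
to an element that shifts them. -/
structure IsArrowLift (E : Cyc s → Ext α) (Y : Ext α) : Prop where
  idempotents : CompleteOrthogonalIdempotents E
  fst_vertex : ∀ i, (E i).1 = pathAt K n i 0
  fst_arrow : Y.1 = arrowSum K s n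
  shift : ∀ i, E i * Y = Y * E (i + 1)

namespace IsArrowLift

variable {E : Cyc s → Ext α} {Y : Ext α}

theorem fst_pow (h : IsArrowLift E Y) (m : ℕ) : (Y ^ m).1 = arrowSum K s n ^ m := by
  change extFst α (Y ^ m) = _
  rw [map_pow, extFst_apply, h.fst_arrow]

theorem fst_pow_self (h : IsArrowLift E Y) : (Y ^ n).1 = 0 := by
  rw [h.fst_pow, arrowSum_pow_of_le le_rfl]

theorem mul_pow (h : IsArrowLift E Y) (i : Cyc s) (m : ℕ) :
    E i * Y ^ m = Y ^ m * E (i + (m : Cyc s)) := by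
  induction m with
  | zero => simp
  | succ m ih =>
    rw [pow_succ, ← mul_assoc, ih, mul_assoc, h.shift, ← mul_assoc]
    congr 2
    push_cast; ring

theorem path_mul_path (h : IsArrowLift E Y) (i j : Cyc s) (l m : ℕ) :
    (E i * Y ^ l) * (E j * Y ^ m) = if j = i + (l : Cyc s) then E i * Y ^ (l + m) else 0 := by
  rw [h.mul_pow i l, mul_assoc, ← mul_assoc (E _) (E j), h.idempotents.mul_eq]
  by_cases hj : j = i + (l : Cyc s)
  · rw [if_pos hj.symm, if_pos hj, ← mul_assoc, ← h.mul_pow, mul_assoc, pow_add]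
  · rw [if_neg (Ne.symm hj), if_neg hj, zero_mul, mul_zero]

/-- The section of `T_α(A) → A` that sends a path to the corresponding product of lifted arrows. -/
def sec (_ : IsArrowLift E Y) : CycleAlgebra K s n →ₗ[K] Ext α := pathLift n fun i l => E i * Y ^ l

theorem sec_pathAt (h : IsArrowLift E Y) (i : Cyc s) (l : ℕ) :
    h.sec (pathAt K n i l) = if l < n then E i * Y ^ l else 0 :=
  pathLift_pathAt _ i l

theorem sec_fst (h : IsArrowLift E Y) (x : CycleAlgebra K s n) : (h.sec x).1 = x := by
  have hid : (extFst α).toLinearMap ∘ₗ h.sec = LinearMap.id := hom_ext_pathAt fun i l hl => by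
    change (h.sec (pathAt K n i l)).1 = pathAt K n i l
    rw [h.sec_pathAt, if_pos hl, Ext.mul_fst, h.fst_vertex, h.fst_pow, pathAt_mul_arrowSum_pow,
      zero_add]
  exact LinearMap.congr_fun hid x

/-- The values of the functional `Y ^ n`, on paths of length `q - n`. -/
def power (_ : IsArrowLift E Y) (q : ℕ) (i : Cyc s) : K :=
  (Y ^ n).2 (pathAt K n (i + (n : Cyc s)) (q - n))

theorem snd_pow_mul_vertex (h : IsArrowLift E Y) (i : Cyc s) (x : CycleAlgebra K s n) :
    (Y ^ n).2 (x * pathAt K n i 0) = (Y ^ n).2 (pathAt K n (i + (n : Cyc s)) 0 * x) := by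
  have hc := congrArg (fun t : Ext α => t.2 x) (h.mul_pow i n)
  simpa [h.fst_pow_self, h.fst_vertex] using hc

theorem snd_pow_mul_arrowSum (h : IsArrowLift E Y) (x : CycleAlgebra K s n) :
    (Y ^ n).2 (x * arrowSum K s n) = (Y ^ n).2 (arrowSum K s n * x) := by
  have hc : (Y * Y ^ n).2 x = (Y ^ n * Y).2 x := by rw [← pow_succ', ← pow_succ]
  rw [Ext.mul_snd, Ext.mul_snd, h.fst_pow_self, h.fst_arrow] at hc
  simpa using hc

/-- As `Y` commutes with `Y ^ n`, the values above degree `n` are constant. -/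
theorem power_add_one (h : IsArrowLift E Y) {q : ℕ} (hq : n < q) (i : Cyc s) :
    h.power q (i + 1) = h.power q i := by
  have hx := h.snd_pow_mul_arrowSum (pathAt K n (i + 1 + (n : Cyc s)) (q - n - 1))
  rw [pathAt_mul_arrowSum, arrowSum_mul_pathAt, show q - n - 1 + 1 = q - n by omega,
    show 1 + (q - n - 1) = q - n by omega, show i + 1 + (n : Cyc s) - 1 = i + (n : Cyc s) by ring]
    at hx
  exact hx

theorem snd_pow_pathAt_eq_zero (h : IsArrowLift E Y) {k : Cyc s} {r : ℕ}
    (hk : k ≠ k + (r : Cyc s) + (n : Cyc s)) : (Y ^ n).2 (pathAt K n k r) = 0 := by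
  have hx := h.snd_pow_mul_vertex (k + (r : Cyc s)) (pathAt K n k r)
  rw [pathAt_mul, if_pos rfl, pathAt_mul, Nat.cast_zero, add_zero, add_zero, if_neg hk] at hx
  rw [hx]
  exact map_zero _

/-- A product of at least `n` lifted arrows is a functional that is nonzero only on paths which
close up the cycle. -/
theorem snd_path_pathAt (h : IsArrowLift E Y) {i j k : Cyc s} {l m r : ℕ} (hlm : n ≤ l + m)
    (hj : j = i + (l : Cyc s)) :
    (E i * Y ^ (l + m)).2 (pathAt K n k r) =
      if (k = j + (m : Cyc s) ∧ i = k + (r : Cyc s)) ∧ l + m + r < 2 * n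
      then h.power (l + m + r) i else 0 := by
  obtain ⟨c, hc⟩ := Nat.exists_eq_add_of_le hlm
  have hcC : (l : Cyc s) + (m : Cyc s) = n + c := by
    rw [← Nat.cast_add, hc, Nat.cast_add]
  have h1 : (E i * Y ^ (l + m)).2 (pathAt K n k r) =
      (Y ^ n).2 (arrowSum K s n ^ c * (pathAt K n k r * pathAt K n i 0)) := by
    have h0 : (Y ^ n * Y ^ c).1 = 0 := by rw [Ext.mul_fst, h.fst_pow_self, zero_mul]
    rw [hc, pow_add, snd_mul_of_fst_right h0, snd_mul_of_fst_left h.fst_pow_self, h.fst_pow,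
      h.fst_vertex]
  rw [h1, pathAt_mul]
  by_cases hi : i = k + (r : Cyc s)
  · rw [if_pos hi, arrowSum_pow_mul_pathAt]
    by_cases hk : k = j + (m : Cyc s)
    · have hkc : k - (c : Cyc s) = i + n := by
        rw [hk, hj]; linear_combination hcC
      by_cases hlt : l + m + r < 2 * n
      · rw [if_pos ⟨⟨hk, hi⟩, hlt⟩, hkc, add_zero, power, show l + m + r - n = c + r by omega]
      · rw [if_neg (by tauto), pathAt_of_le _ (by omega)]
        exact map_zero _
    · rw [if_neg (by tauto)]
      refine h.snd_pow_pathAt_eq_zero fun hk' => hk ?_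
      push_cast at hk'
      rw [hj]
      linear_combination hk' - hi - hcC
  · rw [if_neg hi, if_neg (by tauto), mul_zero]
    exact map_zero _

/-- The section is multiplicative up to the cocycles `Θ(g)`. -/
theorem sec_mul_sub (hn : 2 ≤ n) (h : IsArrowLift E Y) (x y z : CycleAlgebra K s n) :
    (h.sec x * h.sec y - h.sec (x * y)).2 z =
      ∑ q ∈ Finset.Icc n (2 * n - 1), theta (startFunctional K n q (h.power q)) x y z := by
  let B : Cochain₂ K (CycleAlgebra K s n) := LinearMap.mk₂ K
    (fun x y => (h.sec x * h.sec y - h.sec (x * y)).2)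
    (fun x x' y => congrArg Prod.snd (show h.sec (x + x') * h.sec y - h.sec ((x + x') * y) =
      (h.sec x * h.sec y - h.sec (x * y)) + (h.sec x' * h.sec y - h.sec (x' * y)) by
        simp only [map_add, add_mul]; abel))
    (fun c x y => congrArg Prod.snd (show h.sec (c • x) * h.sec y - h.sec ((c • x) * y) =
      c • (h.sec x * h.sec y - h.sec (x * y)) by
        simp only [map_smul, smul_mul_assoc, smul_sub]))
    (fun x y y' => congrArg Prod.snd (show h.sec x * h.sec (y + y') - h.sec (x * (y + y')) =
      (h.sec x * h.sec y - h.sec (x * y)) + (h.sec x * h.sec y' - h.sec (x * y')) by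
        simp only [map_add, mul_add]; abel))
    (fun c x y => congrArg Prod.snd (show h.sec x * h.sec (c • y) - h.sec (x * (c • y)) =
      c • (h.sec x * h.sec y - h.sec (x * y)) by
        simp only [map_smul, mul_smul_comm, smul_sub]))
  have hsum : ∀ x y z, (∑ q ∈ Finset.Icc n (2 * n - 1),
      theta (startFunctional K n q (h.power q))) x y z =
        ∑ q ∈ Finset.Icc n (2 * n - 1), theta (startFunctional K n q (h.power q)) x y z := by
    intro x y z
    rw [LinearMap.sum_apply, LinearMap.sum_apply]
    exact LinearMap.sum_apply _ _ _
  suffices hB : B = ∑ q ∈ Finset.Icc n (2 * n - 1), theta (startFunctional K n q (h.power q)) by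
    rw [← hsum, ← hB]; rfl
  refine cochain_ext fun i j k l m r hl hm hr => ?_
  rw [hsum]
  change (h.sec _ * h.sec _ - h.sec _).2 _ = _
  simp only [theta_pathAt, h.sec_pathAt, if_pos hl, if_pos hm, h.path_mul_path, pathAt_mul]
  by_cases hj : j = i + (l : Cyc s)
  · rw [if_pos hj, if_pos hj, h.sec_pathAt]
    by_cases hlm : l + m < n
    · rw [if_pos hlm, sub_self, Finset.sum_eq_zero]
      · rfl
      · intro q _
        rw [if_neg (by omega)]
    · rw [if_neg hlm, sub_zero, h.snd_path_pathAt (m := m) (by omega) hj]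
      by_cases hc : (k = j + (m : Cyc s) ∧ i = k + (r : Cyc s)) ∧ l + m + r < 2 * n
      · rw [if_pos hc, Finset.sum_eq_single (l + m + r), if_pos]
        · exact ⟨⟨hj, hc.1⟩, ⟨hl, hm, hr⟩, by omega, rfl, hc.2⟩
        · intro q _ hq
          rw [if_neg]
          rintro ⟨-, -, -, h', -⟩
          exact hq h'.symm
        · intro h'
          rw [Finset.mem_Icc] at h'
          omega
      · rw [if_neg hc, Finset.sum_eq_zero]
        intro q _
        rw [if_neg]
        rintro ⟨h1, -, -, h2, h3⟩
        exact hc ⟨h1.2, by omega⟩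
  · rw [if_neg hj, if_neg hj, map_zero, sub_zero, Finset.sum_eq_zero]
    · rfl
    · intro q _
      rw [if_neg (by tauto)]

end IsArrowLift

variable (α) in
theorem exists_isArrowLift : ∃ (E : Cyc s → Ext α) (Y : Ext α),
    IsArrowLift E Y := by
  obtain ⟨E, hE, hE1⟩ := (completeOrthogonalIdempotents_pathAt (K := K) (s := s)
    (n := n)).lift_of_isNilpotent_ker (extFst α).toRingHom
    (fun t ht => isNilpotent_of_fst ht) (fun i => ⟨extInl (pathAt K n i 0), rfl⟩)
  have hE1' : ∀ i, (E i).1 = pathAt K n i 0 := fun i => congrFun hE1 i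
  have hmul := hE.mul_eq
  refine ⟨E, ∑ j, E j * extInl (arrowSum K s n) * E (j + 1), hE, hE1', ?_, fun i => ?_⟩
  · change extFst α _ = _
    rw [map_sum]
    simp only [map_mul, extFst_apply, hE1', extInl_fst, pathAt_mul_arrowSum, pathAt_mul]
    simp [arrowSum]
  · rw [Finset.mul_sum, Finset.sum_mul, Finset.sum_eq_single i, Finset.sum_eq_single i]
    · rw [← mul_assoc, ← mul_assoc, (hE.idem i).eq, mul_assoc (E i * _) _ (E (i + 1)),
        (hE.idem (i + 1)).eq]
    · intro j _ hj
      rw [mul_assoc, hmul, if_neg (by simpa using hj), mul_zero]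
    · simp
    · intro j _ hj
      rw [← mul_assoc, ← mul_assoc, hmul, if_neg (Ne.symm hj), zero_mul, zero_mul]
    · simp

/-- Every cocycle is a sum of cocycles `Θ(g)` and a coboundary. -/
theorem exists_eq_sum_theta_add_coboundary (hn : 2 ≤ n) (α : cocycles K (CycleAlgebra K s n)) :
    ∃ γ : ℕ → Cyc s → K, (∀ q, n < q → ∀ i, γ q (i + 1) = γ q i) ∧
      ∃ φ : CycleAlgebra K s n →ₗ[K] D K (CycleAlgebra K s n), ∀ x y z,
        α.1 x y z = ∑ q ∈ Finset.Icc n (2 * n - 1), theta (startFunctional K n q (γ q)) x y z +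
          (φ y (z * x) - φ (x * y) z + φ x (y * z)) := by
  obtain ⟨E, Y, h⟩ := exists_isArrowLift α
  refine ⟨h.power, fun q hq i => h.power_add_one hq i,
    -(LinearMap.snd K (CycleAlgebra K s n) (D K _) ∘ₗ h.sec), fun x y z => ?_⟩
  rw [← h.sec_mul_sub hn]
  change _ = ((h.sec x * h.sec y).2 z - (h.sec (x * y)).2 z) +
    (-(h.sec y).2 (z * x) - -(h.sec (x * y)).2 z + -(h.sec x).2 (y * z))
  rw [Ext.mul_snd, h.sec_fst, h.sec_fst]
  simp
  ring

theorem exists_theta_of_mem_thetaImage {q : ℕ} {c : Cohomology₂ K (CycleAlgebra K s n)}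
    (hc : c ∈ thetaImage K (Cyc s) n q) :
    ∃ (γ : Cyc s → K) (δ : cocycles K (CycleAlgebra K s n)),
      δ.1 = theta (startFunctional K n q γ) ∧ c = cls δ := by
  obtain ⟨f, g, δ, -, hδ, rfl⟩ := hc
  obtain ⟨γ, rfl⟩ := exists_eq_startFunctional g
  exact ⟨γ, δ, hδ, rfl⟩

theorem cls_eq_iff {A : Type*} [Ring A] [Algebra K A] {α β : cocycles K A} :
    cls α = cls β ↔ ∃ φ : A →ₗ[K] D K A, ∀ x y z,
      α.1 x y z = β.1 x y z + (φ y (z * x) - φ (x * y) z + φ x (y * z)) := by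
  have h : cls α = cls β ↔ α.1 - β.1 ∈ coboundaries K A := by
    rw [Subtype.ext_iff]
    exact Submodule.Quotient.eq _
  rw [h]
  refine exists_congr fun φ => forall_congr' fun x => forall_congr' fun y => ?_
  constructor
  · intro h z
    have := DFunLike.congr_fun h z
    simp at this
    linear_combination this
  · intro h
    ext z
    simp [h z]

theorem cls_sum {A : Type*} [Ring A] [Algebra K A] (t : Finset ℕ) (β : ℕ → cocycles K A) :
    cls (∑ q ∈ t, β q) = ∑ q ∈ t, cls (β q) :=
  map_sum cls β t

theorem cocycle_sum_apply {A : Type*} [Ring A] [Algebra K A] (t : Finset ℕ)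
    (β : ℕ → cocycles K A) (x y z : A) :
    (∑ q ∈ t, β q).1 x y z = ∑ q ∈ t, (β q).1 x y z := by
  have hsum : ∀ f : ℕ → D K A, (∑ q ∈ t, f q) z = ∑ q ∈ t, f q z := fun f =>
    LinearMap.sum_apply _ _ _
  rw [← hsum, Submodule.coe_sum, LinearMap.sum_apply, LinearMap.sum_apply]

theorem exists_isDecomposition (hn : 2 ≤ n) (α : cocycles K (CycleAlgebra K s n)) :
    ∃ β : ℕ → cocycles K (CycleAlgebra K s n), IsDecomposition α β := by
  obtain ⟨γ, hγ, φ, hφ⟩ := exists_eq_sum_theta_add_coboundary hn α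
  refine ⟨fun q => ⟨theta (startFunctional K n q (γ q)), theta_mem_cocycles _ (hγ q)⟩,
    fun q _ => cls_theta_mem_thetaImage _ (hγ q), ?_⟩
  rw [← cls_sum, cls_eq_iff]
  refine ⟨φ, fun x y z => ?_⟩
  rw [hφ, cocycle_sum_apply]

set_option maxHeartbeats 400000 in
/-- On the paths of length `n - 1`, only the top component of a decomposition matters. -/
theorem IsDecomposition.apply_socle (hn : 2 ≤ n) {α : cocycles K (CycleAlgebra K s n)}
    {β : ℕ → cocycles K (CycleAlgebra K s n)} (h : IsDecomposition α β)
    {δ : cocycles K (CycleAlgebra K s n)} (hδ : cls (β (2 * n - 1)) = cls δ) :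
    ∃ φ : CycleAlgebra K s n →ₗ[K] D K (CycleAlgebra K s n), ∀ x y k,
      α.1 x y (pathAt K n k (n - 1)) = δ.1 x y (pathAt K n k (n - 1)) +
        (φ y (pathAt K n k (n - 1) * x) - φ (x * y) (pathAt K n k (n - 1)) +
          φ x (y * pathAt K n k (n - 1))) := by
  have hex : ∀ q, ∃ δ' : cocycles K (CycleAlgebra K s n), q ∈ Finset.Icc n (2 * n - 1) →
      cls (β q) = cls δ' ∧ ∀ x y k, δ'.1 x y (pathAt K n k (n - 1)) =
        if q = 2 * n - 1 then δ.1 x y (pathAt K n k (n - 1)) else 0 := by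
    intro q
    by_cases hq : q = 2 * n - 1
    · exact ⟨δ, fun _ => ⟨by rw [hq, hδ], fun x y k => by rw [if_pos hq]⟩⟩
    · by_cases hq' : q ∈ Finset.Icc n (2 * n - 1)
      · obtain ⟨γ, δ', hg, hc⟩ := exists_theta_of_mem_thetaImage (h.1 q hq')
        refine ⟨δ', fun _ => ⟨hc, fun x y k => ?_⟩⟩
        rw [hg, theta_socle hq, if_neg hq]
      · exact ⟨0, fun h' => absurd h' hq'⟩
  choose δ' hδ' using hex
  have hcls : cls α = cls (∑ q ∈ Finset.Icc n (2 * n - 1), δ' q) := by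
    rw [cls_sum]
    exact h.2.trans (Finset.sum_congr rfl fun q hq => (hδ' q hq).1)
  obtain ⟨φ, hφ⟩ := cls_eq_iff.1 hcls
  refine ⟨φ, fun x y k => ?_⟩
  rw [hφ, cocycle_sum_apply, Finset.sum_congr rfl fun q hq => (hδ' q hq).2 x y k,
    Finset.sum_ite_eq', if_pos (Finset.mem_Icc.2 (by omega))]

theorem IsDecomposition.sameOrdinaryQuiver (hn : 2 ≤ n) {α : cocycles K (CycleAlgebra K s n)}
    {β : ℕ → cocycles K (CycleAlgebra K s n)} (h : IsDecomposition α β)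
    (hβ : cls (β (2 * n - 1)) = 0) :
    SameOrdinaryQuiver K (Ext α) (Ext (0 : cocycles K (CycleAlgebra K s n))) := by
  obtain ⟨φ, hφ⟩ := h.apply_socle hn (δ := 0) (by rw [hβ, map_zero])
  refine ⟨Cyc s, trivialExtensionQuiver s n, hasOrdinaryQuiver_trivialExtension hn φ ?_,
    hasOrdinaryQuiver_trivialExtension hn 0 ?_⟩
  · intro x y k
    rw [hφ]; simp
  · intro x y k
    simp

theorem IsDecomposition.hasOrdinaryQuiver (hn : 2 ≤ n) {α : cocycles K (CycleAlgebra K s n)}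
    {β : ℕ → cocycles K (CycleAlgebra K s n)} (h : IsDecomposition α β)
    (hβ : cls (β (2 * n - 1)) ≠ 0) :
    HasOrdinaryQuiver K (Ext α) (cyclicQuiver s) := by
  obtain ⟨γ, δ, hδ, hc, hγ⟩ := exists_const_of_mem_thetaImage (by omega) (by omega)
    (h.1 (2 * n - 1) (Finset.mem_Icc.2 (by omega)))
  have hδ0 : theta (startFunctional K n (2 * n - 1) γ) ≠ 0 := by
    intro h0
    refine hβ ?_
    rw [hc, show δ = 0 from Subtype.ext (hδ.trans h0), map_zero]
  obtain ⟨hs, i, hi⟩ : ((2 * n - 1 : ℕ) : Cyc s) = 0 ∧ ∃ i, γ i ≠ 0 := by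
    by_contra! hcon
    exact hδ0 (theta_eq_zero γ hcon)
  have hconst : ∀ k, γ k = γ i := by
    have hadd : ∀ (m : ℕ) (j : Cyc s), γ (j + (m : Cyc s)) = γ j := by
      intro m j
      induction m with
      | zero => simp
      | succ m ih => rw [Nat.cast_succ, ← add_assoc, hγ hs, ih]
    intro k
    obtain ⟨m, hm⟩ := ZMod.natCast_zmod_surjective (n := s) (k - i)
    have : k = i + (m : Cyc s) := by
      have hm' : (m : Cyc s) = k - i := hm
      rw [hm']; ring
    rw [this, hadd]
  obtain ⟨φ, hφ⟩ := h.apply_socle hn hc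
  refine hasOrdinaryQuiver_cyclic hn hi fun k => ?_
  have hn0 : 0 < n := by omega
  have hX : arrowSum K s n ^ (n - 1) * arrowSum K s n = 0 := by
    rw [← pow_succ, Nat.sub_add_cancel (by omega), arrowSum_pow_of_le le_rfl]
  -- All three products that occur in a coboundary have length at least `n`.
  rw [hφ, hδ, theta_arrowSum_socle hn hs, hconst, hX, pathAt_mul_arrowSum_pow,
    arrowSum_mul_pathAt, pathAt_of_le _ (l := n - 1 + (n - 1)) (by omega),
    pathAt_of_le _ (l := 1 + (n - 1)) (by omega)]
  simp

end Decomposition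

end HochNak

end

theorem corollary4p4 {K : Type*} [Field K] (s n : ℕ) [NeZero s] (hn : 2 ≤ n)
    (α : HochNak.cocycles K (HochNak.CycleAlgebra K s n)) :
    (∃ β : ℕ → HochNak.cocycles K (HochNak.CycleAlgebra K s n), HochNak.IsDecomposition α β) ∧
    (∀ β : ℕ → HochNak.cocycles K (HochNak.CycleAlgebra K s n), HochNak.IsDecomposition α β →
      (HochNak.cls (β (2 * n - 1)) = 0 →
        HochNak.SameOrdinaryQuiver K (HochNak.Ext α)
          (HochNak.Ext (0 : HochNak.cocycles K (HochNak.CycleAlgebra K s n)))) ∧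
      (HochNak.cls (β (2 * n - 1)) ≠ 0 →
        HochNak.HasOrdinaryQuiver K (HochNak.Ext α) (HochNak.cyclicQuiver s))) ∧
    (HochNak.SameOrdinaryQuiver K (HochNak.Ext α)
        (HochNak.Ext (0 : HochNak.cocycles K (HochNak.CycleAlgebra K s n))) ∨
      HochNak.HasOrdinaryQuiver K (HochNak.Ext α) (HochNak.cyclicQuiver s)) := by
  have hex := HochNak.exists_isDecomposition hn α
  refine ⟨hex, fun β hβ => ⟨hβ.sameOrdinaryQuiver hn, hβ.hasOrdinaryQuiver hn⟩, ?_⟩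
  obtain ⟨β, hβ⟩ := hex
  by_cases h : HochNak.cls (β (2 * n - 1)) = 0
  · exact Or.inl (hβ.sameOrdinaryQuiver hn h)
  · exact Or.inr (hβ.hasOrdinaryQuiver hn h)
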